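/- Let $N\ge 1$, $n\ge 0$ be integers, let $q=(q_1,\dots,q_N)\in(\mathbb C^\times)^N$ have pairwise distinct coordinates, and let $\lambda=(\lambda_1,\dots,\lambda_N)\in\mathbb Z_{\ge0}^N$ with $\lambda_1+\dots+\lambda_N=n$. For $b=(b_1,\dots,b_n)\in\mathbb C^n$ let $V(b)=\mathbb C^N(b_1)\otimes\dots\otimes\mathbb C^N(b_n)$ be the tensor product of evaluation vector representations of the Yangian $Y(\mathfrak{gl}_N)$; as a $\mathfrak{gl}_N$-module it is $(\mathbb C^N)^{\otimes n}$ for every $b$. Let $V(b)_\lambda=\{v : e_{i,i}v=\lambda_i v,\ i=1,\dots,N\}$ be its weight subspace. Let $v_1,\dots,v_N$ be the standard basis of $\mathbb C^N$. For a decomposition $I=(I_1,\dots,I_N)$ of $\{1,\dots,n\}$ into disjoint subsets put $v_I=v_{i_1}\otimes\dots\otimes v_{i_n}$, where $i_k=j$ if $k\in I_j$; let $\mathcal I_\lambda$ be the set of all $I$ with $|I_j|=\lambda_j$ for all $j$. Put $l_a=\lambda_{a+1}+\dots+\lambda_N$ for $0\le a\le N$ (so $l_0=n$, $l_N=0$)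 and $l=l_1+\dots+l_{N-1}$. Points of $\mathbb C^l$ are written $t=(t^{(a)}_j)$, $1\le a\le N-1$, $1\le j\le l_a$; put $t^{(0)}=(b_1,\dots,b_n)$. The Bethe ansatz equations associated with $V(b)_\lambda$ and $q$ are, for $a=1,\dots,N-1$ and $j=1,\dots,l_a$, $$q_a\prod_{j'=1}^{l_{a-1}}(t^{(a)}_j-t^{(a-1)}_{j'}+1)\prod_{j'\ne j}(t^{(a)}_j-t^{(a)}_{j'}-1)\prod_{j'=1}^{l_{a+1}}(t^{(a)}_j-t^{(a+1)}_{j'}) = q_{a+1}\prod_{j'=1}^{l_{a-1}}(t^{(a)}_j-t^{(a-1)}_{j'})\prod_{j'\ne j}(t^{(a)}_j-t^{(a)}_{j'}+1)\prod_{j'=1}^{l_{a+1}}(t^{(a)}_j-t^{(a+1)}_{j'}-1).$$ A solution $t$ is called off-diagonal if $t^{(a)}_j\ne t^{(a)}_{j'}$ for $1\le a\le N-1$, $1\le j<j'\le l_a$, and $t^{(a)}_j\neq t^{(a+1)}_{j'}$ for $1\le a\le N-2$, $1\le j\le l_a$, $1\le j'\le l_{a+1}$. For $I\in\mathcal I_\lambda$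 write $\bigcup_{c=a+1}^N I_c=\{i^{(a)}_1<\dots<i^{(a)}_{l_a}\}$, and set $$U_I(t;b)=\prod_{a=1}^{N-1}\prod_{j=1}^{l_a}\Bigl(\prod_{j':\,i^{(a-1)}_{j'}<i^{(a)}_j}(t^{(a)}_j-t^{(a-1)}_{j'}+1)\prod_{j':\,i^{(a-1)}_{j'}>i^{(a)}_j}(t^{(a)}_j-t^{(a-1)}_{j'})\prod_{j'=j+1}^{l_a}\frac{t^{(a)}_j-t^{(a)}_{j'}+1}{t^{(a)}_j-t^{(a)}_{j'}}\Bigr).$$ Let $W_I(t;b)$ be the sum of $U_I$ over all permutations of the variables $t^{(a)}_1,\dots,t^{(a)}_{l_a}$ inside each of the groups $a=1,\dots,N-1$; it is a polynomial in $t$ and $b$. The universal weight function is $\omega_\lambda(t,b)=\sum_{I\in\mathcal I_\lambda}W_I(t;b)\,v_I\in V(b)_\lambda$, and the Bethe vector of an off-diagonal solution $t$ of the Bethe ansatz equations is $\omega_\lambda(t,b)$. **Theorem.** For generic $b$, that is, for all $b$ in some nonempty Zariski open subset of $\mathbb C^n$ (depending on $q$ and $\lambda$), there exists a collection of off-diagonal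 solutions of the Bethe ansatz equations such that the corresponding Bethe vectors form a basis of $V(b)_\lambda$. -/

import Mathlib

open scoped BigOperators

noncomputable section

namespace XXX

/-- The underlying space `(ℂ^N)^{⊗ n}` of the Yangian module
`V(b) = ℂ^N(b_1) ⊗ ⋯ ⊗ ℂ^N(b_n)`. Its `gl_N`-module structure does not depend on `b`. -/
abbrev TensorSpace (N n : ℕ) : Type :=
  PiTensorProduct ℂ (fun _ : Fin n => Fin N → ℂ)

/-- The generator `e_{i,j}` of `gl_N` on `ℂ^N`: it sends `v_k` to `δ_{jk} v_i`. -/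
def glVector {N : ℕ} (i j : Fin N) : (Fin N → ℂ) →ₗ[ℂ] (Fin N → ℂ) :=
  Matrix.toLin' (Matrix.single i j (1 : ℂ))

/-- The generator `e_{i,j}` of `gl_N` on the tensor power: the sum over the tensor factors `s` of
the operator acting as `e_{i,j}` in the factor `s` and as the identity in the other factors. -/
def glTensor {N : ℕ} (n : ℕ) (i j : Fin N) : Module.End ℂ (TensorSpace N n) :=
  ∑ s : Fin n, PiTensorProduct.map
    (Function.update (fun _ : Fin n => (LinearMap.id : (Fin N → ℂ) →ₗ[ℂ] (Fin N → ℂ)))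
      s (glVector i j))

/-- The weight subspace `V(b)_λ`: all vectors `v` with `e_{i,i} v = λ_i v` for every `i`. -/
def weightSpace {N : ℕ} (n : ℕ) (lam : Fin N → ℕ) : Submodule ℂ (TensorSpace N n) :=
  ⨅ i : Fin N, Module.End.eigenspace (glTensor n i i) (lam i : ℂ)

/-- The basis vector `v_I = v_{i_1} ⊗ ⋯ ⊗ v_{i_n}`. A decomposition `(I_1, …, I_N)` of the set of
positions is encoded by the map `I` that sends a position to the index of the part it lies in. -/
def basisVector {N n : ℕ} (I : Fin n → Fin N) : TensorSpace N n :=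
  PiTensorProduct.tprod ℂ (fun s => (Pi.single (I s) (1 : ℂ) : Fin N → ℂ))

/-- The set `𝓘_λ` of decompositions whose `j`-th part has `λ_j` elements. -/
abbrev IndexSet {N : ℕ} (n : ℕ) (lam : Fin N → ℕ) : Type :=
  {I : Fin n → Fin N // ∀ j : Fin N, (Finset.univ.filter (fun s => I s = j)).card = lam j}

/-- The numbers `l_0 = n` and `l_a = λ_{a+1} + ⋯ + λ_N` for `a ≥ 1`. The parts are numbered from `0`
here, so that the sum is over the indices `i ≥ a`. -/
def levelSize {N : ℕ} (n : ℕ) (lam : Fin N → ℕ) : ℕ → ℕ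
  | 0 => n
  | a + 1 => ∑ i ∈ Finset.univ.filter (fun i : Fin N => a + 1 ≤ (i : ℕ)), lam i

/-- The points of `ℂ^l`, `l = l_1 + ⋯ + l_{N-1}`: the coordinates `t^{(a)}_j` for
`1 ≤ a ≤ N - 1` and `1 ≤ j ≤ l_a`; the group `t^{(a)}` is stored at the index `a - 1`. -/
abbrev Variables {N : ℕ} (n : ℕ) (lam : Fin N → ℕ) : Type :=
  (a : Fin (N - 1)) → Fin (levelSize n lam (a + 1)) → ℂ

/-- All groups of variables: `t^{(0)} = b`, then `t^{(1)}, …, t^{(N-1)}`. For `a ≥ N` the group is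
empty, since `l_a = 0`. -/
def groups {N n : ℕ} {lam : Fin N → ℕ} (b : Fin n → ℂ) (t : Variables n lam) :
    (a : ℕ) → Fin (levelSize n lam a) → ℂ
  | 0 => b
  | a + 1 => fun j => if h : a < N - 1 then t ⟨a, h⟩ j else 0

/-- `t` solves the Bethe ansatz equations associated with `V(b)_λ` and `q`. With `t^{(0)} = b` and
an empty group `t^{(N)}` all equations have the same form. In the code the equation for
`t^{(a+1)}_j` is written, with `q a` and `q (a + 1)` for `q_{a+1}` and `q_{a+2}`. -/
def IsBetheSolution {N n : ℕ} {lam : Fin N → ℕ} (q : Fin N → ℂ) (b : Fin n → ℂ)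
    (t : Variables n lam) : Prop :=
  ∀ (a : ℕ) (ha : a + 1 < N) (j : Fin (levelSize n lam (a + 1))),
    q ⟨a, Nat.lt_of_succ_lt ha⟩
        * (∏ j' : Fin (levelSize n lam a), (groups b t (a + 1) j - groups b t a j' + 1))
        * (∏ j' ∈ Finset.univ.erase j, (groups b t (a + 1) j - groups b t (a + 1) j' - 1))
        * (∏ j' : Fin (levelSize n lam (a + 2)), (groups b t (a + 1) j - groups b t (a + 2) j'))
      = q ⟨a + 1, ha⟩
        * (∏ j' : Fin (levelSize n lam a), (groups b t (a + 1) j - groups b t a j'))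
        * (∏ j' ∈ Finset.univ.erase j, (groups b t (a + 1) j - groups b t (a + 1) j' + 1))
        * (∏ j' : Fin (levelSize n lam (a + 2)),
            (groups b t (a + 1) j - groups b t (a + 2) j' - 1))

/-- `t` is off-diagonal: the coordinates inside each group are distinct, and coordinates of
neighbouring groups `t^{(a)}`, `t^{(a+1)}`, `1 ≤ a ≤ N - 2`, are distinct. -/
def IsOffDiagonal {N n : ℕ} {lam : Fin N → ℕ} (t : Variables n lam) : Prop :=
  (∀ (a : Fin (N - 1)) (j j' : Fin (levelSize n lam (a + 1))), j < j' → t a j ≠ t a j') ∧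
  (∀ (a a' : Fin (N - 1)), (a' : ℕ) = a + 1 →
    ∀ (j : Fin (levelSize n lam (a + 1))) (j' : Fin (levelSize n lam (a' + 1))), t a j ≠ t a' j')

/-- The set of positions `⋃_{c > a} I_c` (with the parts numbered from `1`). -/
def upperSet {N n : ℕ} (I : Fin n → Fin N) (a : ℕ) : Finset (Fin n) :=
  Finset.univ.filter (fun s => a ≤ (I s : ℕ))

theorem card_upperSet {N n : ℕ} {lam : Fin N → ℕ} (I : IndexSet n lam) (a : ℕ) :
    (upperSet I.1 a).card = levelSize n lam a := by
  cases a with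
  | zero => simp [upperSet, levelSize]
  | succ a =>
    have hmaps : ∀ s ∈ upperSet I.1 (a + 1),
        I.1 s ∈ Finset.univ.filter (fun i : Fin N => a + 1 ≤ (i : ℕ)) := by
      intro s hs
      simpa [upperSet] using hs
    rw [Finset.card_eq_sum_card_fiberwise hmaps, levelSize]
    refine Finset.sum_congr rfl fun i hi => ?_
    rw [← I.2 i]
    congr 1
    ext s
    simp only [upperSet, Finset.mem_filter, Finset.mem_univ, true_and] at hi ⊢
    constructor
    · exact fun h => h.2
    · rintro rfl
      exact ⟨hi, rfl⟩

/-- The positions `i^{(a)}_1 < ⋯ < i^{(a)}_{l_a}` of `⋃_{c > a} I_c`, in increasing order. -/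
def position {N n : ℕ} {lam : Fin N → ℕ} (I : IndexSet n lam) (a : ℕ)
    (j : Fin (levelSize n lam a)) : Fin n :=
  (upperSet I.1 a).orderEmbOfFin (card_upperSet I a) j

/-- The function `U_I(t; b)`; the product over `a : Fin (N - 1)` is the product over the groups
`t^{(1)}, …, t^{(N-1)}`. -/
def weightU {N n : ℕ} {lam : Fin N → ℕ} (I : IndexSet n lam) (t : Variables n lam)
    (b : Fin n → ℂ) : ℂ :=
  ∏ a : Fin (N - 1), ∏ j : Fin (levelSize n lam (a + 1)),
    ((∏ j' ∈ Finset.univ.filter (fun j' : Fin (levelSize n lam a) =>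
          position I a j' < position I (a + 1) j), (t a j - groups b t a j' + 1))
      * (∏ j' ∈ Finset.univ.filter (fun j' : Fin (levelSize n lam a) =>
          position I (a + 1) j < position I a j'), (t a j - groups b t a j'))
      * (∏ j' ∈ Finset.univ.filter (fun j' : Fin (levelSize n lam (a + 1)) => j < j'),
          (t a j - t a j' + 1) / (t a j - t a j')))

/-- The weight function `W_I(t; b)`: the sum of `U_I` over all permutations of the variables
inside each group. The sum is a polynomial in `t` and `b`; this expression gives its values at the
points whose coordinates are distinct inside each group, in particular at off-diagonal points. -/
def weightW {N n : ℕ} {lam : Fin N → ℕ} (I : IndexSet n lam) (t : Variables n lam)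
    (b : Fin n → ℂ) : ℂ :=
  ∑ σ : (a : Fin (N - 1)) → Equiv.Perm (Fin (levelSize n lam (a + 1))),
    weightU I (fun a j => t a (σ a j)) b

/-- The universal weight function `ω_λ(t, b) = ∑_I W_I(t; b) v_I`. Its value at an off-diagonal
solution of the Bethe ansatz equations is the Bethe vector of that solution. -/
def universalWeight {N n : ℕ} {lam : Fin N → ℕ} (t : Variables n lam) (b : Fin n → ℂ) :
    TensorSpace N n :=
  ∑ I : IndexSet n lam, weightW I t b • basisVector I.1

end XXX

end

/-!
The solutions are constructed near infinity and then transported to a Zariski open set.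

Replace `b` by `ε⁻¹ b`, with distinct `b_s` and `ε → 0`. For a decomposition `I`, look for a
solution whose variables form clusters: a site `s` in the part `m` carries one variable
`ε⁻¹ b_s + y_{a,s}` of each level `1 ≤ a < m`, and `y_{0,s} = 0`. Once multiplied by suitable powers
of `ε`, the Bethe equations extend to `ε = 0`, where the clusters decouple and the steps
`y_{a,s} - y_{a-1,s}` may be taken to be `q_a / (q_m - q_a)` (`scaledSystem_baseShift`). The
linearised limit system is triangular within each cluster with nonzero diagonal, since the `q_a` are
distinct and nonzero (`eq_zero_of_hasDerivAt_scaledSystem`), so the implicit function theorem gives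
a solution for all small `ε` (`exists_cluster_solution`). It is off-diagonal because the `b_s` are
distinct and the steps are nonzero in the limit.

In each summand of `W_J` at the solution labelled by `I`, the factors that may grow like `ε⁻¹` are
the same in number. One of them stays bounded unless each variable sits at the position of its own
cluster, which forces `J = I` and the trivial permutation (`eq_of_leadingU_ne_zero`). Hence the
matrix of coordinates of the Bethe vectors is asymptotically diagonal after a rescaling of its
columns, and its determinant is nonzero for small `ε ≠ 0` (`eventually_det_weightW_ne_zero`). As the
`v_I`, `I ∈ 𝓘_λ`, are a basis of the weight subspace, so are these Bethe vectors.

The set of all `b` with a family of off-diagonal solutions of nonzero determinant is the projection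
of a closed algebraic set, the inequalities being expressed by auxiliary inverses
(`exists_auxCondition_iff`). On each line through the origin and a point with distinct coordinates
it contains all points close to infinity, so it is Zariski dense
(`eq_zero_of_frequently_eval_eq_zero`). By Chevalley's theorem a dense projection contains a nonempty
Zariski open set (`exists_ne_zero_of_dense_projection`).
-/

noncomputable section

namespace XXX

/-! ### Projections of closed algebraic sets -/

/-- If some prime ideal of `ℂ[b, x] / I` lies over the maximal ideal of the point `b`, then the
equations in `I` have a solution over `b`, by the Nullstellensatz. -/
theorem exists_common_zero_of_mem_range_comap {σ τ : Type*} [Finite σ] [Finite τ]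
    (I : Ideal (MvPolynomial (σ ⊕ τ) ℂ)) (b : σ → ℂ)
    (p : PrimeSpectrum (MvPolynomial (σ ⊕ τ) ℂ ⧸ I))
    (hp : ∀ f : MvPolynomial σ ℂ, MvPolynomial.eval b f = 0 →
      Ideal.Quotient.mk I (MvPolynomial.rename Sum.inl f) ∈ p.asIdeal) :
    ∃ x : τ → ℂ, ∀ f ∈ I, MvPolynomial.eval (Sum.elim b x) f = 0 := by
  obtain ⟨M, hM, hpM⟩ := Ideal.exists_le_maximal (p.asIdeal.comap (Ideal.Quotient.mk I))
    (Ideal.IsPrime.comap (Ideal.Quotient.mk I)).ne_top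
  obtain ⟨y, rfl⟩ := MvPolynomial.eq_vanishingIdeal_singleton_of_isMaximal (K := ℂ) hM
  have hyb : ∀ s, y (Sum.inl s) = b s := by
    intro s
    have h1 : Ideal.Quotient.mk I (MvPolynomial.rename Sum.inl
        (MvPolynomial.X s - MvPolynomial.C (b s))) ∈ p.asIdeal := hp _ (by simp)
    have h2 := hpM (Ideal.mem_comap.2 h1)
    rw [MvPolynomial.mem_vanishingIdeal_singleton_iff] at h2
    simpa [sub_eq_zero] using h2
  refine ⟨fun j => y (Sum.inr j), fun f hf => ?_⟩
  have h2 : f ∈ MvPolynomial.vanishingIdeal ℂ {y} := by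
    refine hpM (Ideal.mem_comap.2 ?_)
    rw [Ideal.Quotient.eq_zero_iff_mem.2 hf]
    exact zero_mem _
  rw [MvPolynomial.mem_vanishingIdeal_singleton_iff, MvPolynomial.aeval_eq_eval] at h2
  have : Sum.elim b (fun j => y (Sum.inr j)) = y := by
    ext (s | s)
    · simp [hyb]
    · simp
  rw [this]
  exact h2

/-- The projection of a closed algebraic set, if Zariski dense, contains a nonempty Zariski open
set. By Chevalley's theorem the projection of the scheme is constructible, and density means that
it contains the generic point. -/
theorem exists_ne_zero_of_dense_projection {σ τ : Type*} [Finite σ] [Finite τ]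
    (S : Set (MvPolynomial (σ ⊕ τ) ℂ))
    (hdense : ∀ Q : MvPolynomial σ ℂ,
      (∀ (b : σ → ℂ) (x : τ → ℂ), (∀ f ∈ S, MvPolynomial.eval (Sum.elim b x) f = 0) →
        MvPolynomial.eval b Q = 0) → Q = 0) :
    ∃ P : MvPolynomial σ ℂ, P ≠ 0 ∧ ∀ b : σ → ℂ, MvPolynomial.eval b P ≠ 0 →
      ∃ x : τ → ℂ, ∀ f ∈ S, MvPolynomial.eval (Sum.elim b x) f = 0 := by
  classical
  set I := Ideal.span S with hI
  let φ : MvPolynomial σ ℂ →+* (MvPolynomial (σ ⊕ τ) ℂ ⧸ I) :=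
    (Ideal.Quotient.mk I).comp (MvPolynomial.rename (R := ℂ) (Sum.inl : σ → σ ⊕ τ)).toRingHom
  have hinj : Function.Injective φ := by
    rw [injective_iff_map_eq_zero]
    intro Q hQ
    refine hdense Q fun b x hx => ?_
    have h1 : MvPolynomial.rename Sum.inl Q ∈ I := Ideal.Quotient.eq_zero_iff_mem.1 hQ
    have h2 : I ≤ RingHom.ker (MvPolynomial.eval (Sum.elim b x)) :=
      Ideal.span_le.2 fun f hf => hx f hf
    have h3 := h2 h1
    rw [RingHom.mem_ker, MvPolynomial.eval_rename] at h3
    simpa using h3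
  have hfin : φ.FinitePresentation := by
    rw [← RingHom.FinitePresentation.of_finiteType]
    refine RingHom.FiniteType.of_comp_finiteType (f := MvPolynomial.C) ?_
    have : φ.comp MvPolynomial.C = algebraMap ℂ (MvPolynomial (σ ⊕ τ) ℂ ⧸ I) := by
      ext r
      simp only [RingHom.comp_apply, φ, AlgHom.toRingHom_eq_coe, RingHom.coe_coe,
        MvPolynomial.rename_C]
      rfl
    rw [this, RingHom.finiteType_algebraMap]
    infer_instance
  obtain ⟨C, hC⟩ := PrimeSpectrum.exists_constructibleSetData_iff.2
    (PrimeSpectrum.isConstructible_range_comap hfin)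
  obtain ⟨p, hp, hpc⟩ := Ideal.exists_comap_eq_of_mem_minimalPrimes_of_injective hinj ⊥
    (by rw [IsDomain.minimalPrimes_eq_singleton_bot]; rfl)
  have hgen : PrimeSpectrum.comap φ ⟨p, hp⟩ ∈ C.toSet := hC ▸ Set.mem_range_self _
  simp only [PrimeSpectrum.ConstructibleSetData.toSet, Set.mem_iUnion] at hgen
  obtain ⟨D, hDC, hD1, hD2⟩ := hgen
  have hg : ∀ i, D.g i = 0 := by
    intro i
    have h1 : D.g i ∈ p.comap φ := hD1 ⟨i, rfl⟩
    rwa [hpc] at h1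
  have hf : D.f ≠ 0 := by
    intro h
    refine hD2 ?_
    rw [PrimeSpectrum.mem_zeroLocus, Set.singleton_subset_iff, h]
    exact zero_mem _
  refine ⟨D.f, hf, fun b hb => ?_⟩
  let m : PrimeSpectrum (MvPolynomial σ ℂ) := ⟨RingHom.ker (MvPolynomial.eval b),
    RingHom.ker_isPrime _⟩
  have hm : m ∈ Set.range (PrimeSpectrum.comap φ) := by
    rw [← hC]
    simp only [PrimeSpectrum.ConstructibleSetData.toSet, Set.mem_iUnion]
    refine ⟨D, hDC, ?_, ?_⟩
    · rintro _ ⟨i, rfl⟩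
      rw [hg i]
      exact zero_mem _
    · rw [PrimeSpectrum.mem_zeroLocus, Set.singleton_subset_iff]
      exact hb
  obtain ⟨P, hP⟩ := hm
  obtain ⟨x, hx⟩ := exists_common_zero_of_mem_range_comap I b P (fun f hf => by
    have h1 : f ∈ m.asIdeal := hf
    rw [← hP] at h1
    exact h1)
  exact ⟨x, fun f hf => hx f (Ideal.subset_span hf)⟩

/-- The polynomial functions on `ℂ^ι`. -/
def polyFun (ι : Type*) : Subalgebra ℂ ((ι → ℂ) → ℂ) :=
  (MvPolynomial.aeval (R := ℂ) (fun i (x : ι → ℂ) => x i)).range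

theorem exists_eval_eq_of_mem_polyFun {ι : Type*} {f : (ι → ℂ) → ℂ} (hf : f ∈ polyFun ι) :
    ∃ p : MvPolynomial ι ℂ, ∀ x, MvPolynomial.eval x p = f x := by
  obtain ⟨p, rfl⟩ := hf
  refine ⟨p, fun x => ?_⟩
  have h := MvPolynomial.map_aeval (R := ℂ) (fun i (x : ι → ℂ) => x i)
    (Pi.evalRingHom (fun _ : ι → ℂ => ℂ) x) p
  simp only [Pi.evalRingHom_apply] at h
  erw [h]
  rfl

theorem coord_mem_polyFun {ι : Type*} (i : ι) : (fun x : ι → ℂ => x i) ∈ polyFun ι :=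
  ⟨MvPolynomial.X i, by simp⟩

theorem const_mem_polyFun {ι : Type*} (c : ℂ) : (fun _ : ι → ℂ => c) ∈ polyFun ι :=
  (polyFun ι).algebraMap_mem c

theorem fun_add_mem_polyFun {ι : Type*} {f g : (ι → ℂ) → ℂ} (hf : f ∈ polyFun ι)
    (hg : g ∈ polyFun ι) : (fun x => f x + g x) ∈ polyFun ι := add_mem hf hg

theorem fun_sub_mem_polyFun {ι : Type*} {f g : (ι → ℂ) → ℂ} (hf : f ∈ polyFun ι)
    (hg : g ∈ polyFun ι) : (fun x => f x - g x) ∈ polyFun ι := sub_mem hf hg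

theorem fun_mul_mem_polyFun {ι : Type*} {f g : (ι → ℂ) → ℂ} (hf : f ∈ polyFun ι)
    (hg : g ∈ polyFun ι) : (fun x => f x * g x) ∈ polyFun ι := mul_mem hf hg

theorem fun_sum_mem_polyFun {ι κ : Type*} (s : Finset κ) {f : κ → (ι → ℂ) → ℂ}
    (hf : ∀ k ∈ s, f k ∈ polyFun ι) : (fun x => ∑ k ∈ s, f k x) ∈ polyFun ι := by
  convert sum_mem hf using 1
  ext x
  simp

theorem fun_prod_mem_polyFun {ι κ : Type*} (s : Finset κ) {f : κ → (ι → ℂ) → ℂ}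
    (hf : ∀ k ∈ s, f k ∈ polyFun ι) : (fun x => ∏ k ∈ s, f k x) ∈ polyFun ι := by
  convert prod_mem hf using 1
  ext x
  simp

theorem fun_det_mem_polyFun {ι κ : Type*} [Fintype κ] [DecidableEq κ]
    {M : κ → κ → (ι → ℂ) → ℂ} (hM : ∀ i j, M i j ∈ polyFun ι) :
    (fun x => (Matrix.of fun i j => M i j x).det) ∈ polyFun ι := by
  simp only [Matrix.det_apply, Units.smul_def, zsmul_eq_mul, Matrix.of_apply]
  exact fun_sum_mem_polyFun _ fun σ _ => fun_mul_mem_polyFun (const_mem_polyFun _)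
    (fun_prod_mem_polyFun _ fun i _ => hM _ _)

/-- A condition on the points of `ℂ^ι` that amounts to a system of polynomial equations. -/
def IsAlgebraicCondition {ι : Type*} (p : (ι → ℂ) → Prop) : Prop :=
  ∃ S : Set (MvPolynomial ι ℂ), ∀ x, p x ↔ ∀ f ∈ S, MvPolynomial.eval x f = 0

theorem IsAlgebraicCondition.of_eq {ι : Type*} {f g : (ι → ℂ) → ℂ} (hf : f ∈ polyFun ι)
    (hg : g ∈ polyFun ι) : IsAlgebraicCondition fun x => f x = g x := by
  obtain ⟨p, hp⟩ := exists_eval_eq_of_mem_polyFun (fun_sub_mem_polyFun hf hg)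
  exact ⟨{p}, fun x => by simp [hp, sub_eq_zero]⟩

theorem IsAlgebraicCondition.and {ι : Type*} {p q : (ι → ℂ) → Prop}
    (hp : IsAlgebraicCondition p) (hq : IsAlgebraicCondition q) :
    IsAlgebraicCondition fun x => p x ∧ q x := by
  obtain ⟨S, hS⟩ := hp
  obtain ⟨T, hT⟩ := hq
  exact ⟨S ∪ T, fun x => by simp only [hS, hT, Set.mem_union, or_imp, forall_and]⟩

theorem IsAlgebraicCondition.forall {ι : Type*} {κ : Sort*} {p : κ → (ι → ℂ) → Prop}
    (hp : ∀ k, IsAlgebraicCondition (p k)) : IsAlgebraicCondition fun x => ∀ k, p k x := by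
  choose S hS using hp
  refine ⟨⋃ k, S k, fun x => ?_⟩
  simp only [hS, Set.mem_iUnion, forall_exists_index]
  exact forall_comm

/-- A polynomial is zero if, on each line through the origin and a point with distinct coordinates,
it has zeros arbitrarily close to infinity. -/
theorem eq_zero_of_frequently_eval_eq_zero {σ : Type*} [Finite σ] (Q : MvPolynomial σ ℂ)
    (h : ∀ b : σ → ℂ, Function.Injective b →
      ∃ᶠ ε in nhdsWithin (0 : ℂ) {0}ᶜ, MvPolynomial.eval (fun s => ε⁻¹ * b s) Q = 0) :
    Q = 0 := by
  classical
  have := Fintype.ofFinite σ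
  have hline : ∀ b : σ → ℂ, Function.Injective b → MvPolynomial.eval b Q = 0 := by
    intro b hb
    -- the restriction of `Q` to the line through `b`
    let r : Polynomial ℂ := MvPolynomial.aeval (fun s => Polynomial.X * Polynomial.C (b s)) Q
    have hr : ∀ c : ℂ, r.eval c = MvPolynomial.eval (fun s => c * b s) Q := by
      intro c
      have h1 := MvPolynomial.map_aeval (R := ℂ)
        (fun s => Polynomial.X * Polynomial.C (b s)) (Polynomial.evalRingHom c) Q
      simp only [Polynomial.coe_evalRingHom] at h1
      rw [show r.eval c = _ from h1]
      have h2 : (Polynomial.evalRingHom c).comp (algebraMap ℂ (Polynomial ℂ)) = RingHom.id ℂ := by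
        ext; simp
      simp only [h2, Polynomial.eval_mul, Polynomial.eval_X, Polynomial.eval_C]
      rfl
    have hr0 : r = 0 := by
      by_contra hne
      have hfin : (r.roots.toFinset : Set ℂ).Finite := Finset.finite_toSet _
      have h3 : ∃ᶠ ε in nhdsWithin (0 : ℂ) {0}ᶜ, ε⁻¹ ∈ (r.roots.toFinset : Set ℂ) := by
        refine (h b hb).mono fun ε hε => ?_
        simp [hne, hr, hε]
      have h4 : ∀ᶠ ε in nhdsWithin (0 : ℂ) {0}ᶜ, ε⁻¹ ∉ (r.roots.toFinset : Set ℂ) := by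
        exact Filter.tendsto_inv₀_nhdsNE_zero.eventually
          (Bornology.le_cofinite ℂ hfin.compl_mem_cofinite)
      exact h3 h4
    have := hr 1
    simpa [hr0] using this.symm
  let V : MvPolynomial σ ℂ := ∏ p ∈ (Finset.univ.filter fun p : σ × σ => p.1 ≠ p.2),
    (MvPolynomial.X p.1 - MvPolynomial.X p.2)
  have hV : V ≠ 0 := by
    refine Finset.prod_ne_zero_iff.2 fun p hp => ?_
    rw [sub_ne_zero]
    exact fun h => (Finset.mem_filter.1 hp).2 (MvPolynomial.X_injective h)
  have hQV : Q * V = 0 := by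
    refine MvPolynomial.funext fun b => ?_
    by_cases hb : Function.Injective b
    · simp [hline b hb]
    · simp only [Function.Injective, not_forall] at hb
      obtain ⟨i, j, hij, hne⟩ := hb
      have : MvPolynomial.eval b V = 0 := by
        rw [map_prod]
        exact Finset.prod_eq_zero (i := (i, j)) (by simp [hne]) (by simp [hij])
      simp [this]
  exact (mul_eq_zero.1 hQV).resolve_right hV

/-! ### The weight subspace -/

/-- The vectors `v_I`, for all `I`, form a basis of the tensor power. -/
def tensorBasis (N n : ℕ) : Module.Basis (Fin n → Fin N) ℂ (TensorSpace N n) :=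
  Basis.piTensorProduct fun _ => Pi.basisFun ℂ (Fin N)

theorem tensorBasis_apply {N n : ℕ} (I : Fin n → Fin N) : tensorBasis N n I = basisVector I := by
  simp [tensorBasis, basisVector]

/-- The vector `v_I` is a weight vector, its weight being given by the sizes of the parts. -/
theorem glTensor_basisVector {N n : ℕ} (i : Fin N) (I : Fin n → Fin N) :
    glTensor n i i (basisVector I) =
      ((Finset.univ.filter (fun s => I s = i)).card : ℂ) • basisVector I := by
  have h : ∀ s : Fin n, PiTensorProduct.map
      (Function.update (fun _ : Fin n => (LinearMap.id : (Fin N → ℂ) →ₗ[ℂ] (Fin N → ℂ)))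
        s (glVector i i)) (basisVector I) = if I s = i then basisVector I else 0 := by
    intro s
    rw [basisVector, PiTensorProduct.map_tprod]
    have hs : glVector i i (Pi.single (I s) (1 : ℂ)) =
        if I s = i then Pi.single (I s) (1 : ℂ) else 0 := by
      ext k
      by_cases h : I s = i
      · subst h
        simp [glVector, Matrix.single_apply, Pi.single_apply, eq_comm]
      · simp [glVector, h, Ne.symm h]
    split_ifs with hi
    · congr 1
      ext s' k
      by_cases hss : s' = s
      · subst hss
        rw [Function.update_self, hs, if_pos hi]
      · simp [Function.update_of_ne hss]
    · refine MultilinearMap.map_coord_zero _ s ?_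
      rw [Function.update_self, hs, if_neg hi]
  rw [glTensor, LinearMap.sum_apply, Finset.sum_congr rfl fun s _ => h s, ← Finset.sum_filter,
    Finset.sum_const, Nat.cast_smul_eq_nsmul]

theorem basisVector_mem_weightSpace {N n : ℕ} {lam : Fin N → ℕ} (I : IndexSet n lam) :
    basisVector I.1 ∈ weightSpace n lam := by
  simp only [weightSpace, Submodule.mem_iInf, Module.End.mem_eigenspace_iff]
  intro i
  rw [glTensor_basisVector, I.2 i]

theorem repr_eq_zero_of_mem_weightSpace {N n : ℕ} {lam : Fin N → ℕ} {v : TensorSpace N n}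
    (hv : v ∈ weightSpace n lam) {I : Fin n → Fin N} {i : Fin N}
    (hI : (Finset.univ.filter (fun s => I s = i)).card ≠ lam i) :
    (tensorBasis N n).repr v I = 0 := by
  simp only [weightSpace, Submodule.mem_iInf, Module.End.mem_eigenspace_iff] at hv
  have h1 : (tensorBasis N n).repr (glTensor n i i v) I =
      ((Finset.univ.filter (fun s => I s = i)).card : ℂ) * (tensorBasis N n).repr v I := by
    conv_lhs => rw [← (tensorBasis N n).sum_repr v]
    simp only [map_sum, map_smul, tensorBasis_apply, glTensor_basisVector]
    simp only [← tensorBasis_apply, Module.Basis.repr_self]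
    simp [Finsupp.finsetSum_apply, Finsupp.single_apply, mul_comm]
  rw [hv i] at h1
  simp only [map_smul, Finsupp.smul_apply, smul_eq_mul] at h1
  have h2 : (((Finset.univ.filter (fun s => I s = i)).card : ℂ) - lam i) *
      (tensorBasis N n).repr v I = 0 := by linear_combination -h1
  refine (mul_eq_zero.1 h2).resolve_left ?_
  exact fun h => hI (by exact_mod_cast sub_eq_zero.1 h)

/-- The vectors `v_I`, `I ∈ 𝓘_λ`, form a basis of the weight subspace. -/
def weightBasis {N : ℕ} (n : ℕ) (lam : Fin N → ℕ) :
    Module.Basis (IndexSet n lam) ℂ (weightSpace n lam) :=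
  Module.Basis.mk
    (v := fun I : IndexSet n lam =>
      (⟨basisVector I.1, basisVector_mem_weightSpace I⟩ : weightSpace n lam))
    (by
      have h := (tensorBasis N n).linearIndependent.comp (Subtype.val : IndexSet n lam → _)
        Subtype.val_injective
      refine LinearIndependent.of_comp (weightSpace n lam).subtype ?_
      convert h using 1
      ext I
      simp [tensorBasis_apply])
    (by
      rintro ⟨v, hv⟩ -
      have h : (⟨v, hv⟩ : weightSpace n lam) = ∑ I : IndexSet n lam,
          (tensorBasis N n).repr v I.1 •
            (⟨basisVector I.1, basisVector_mem_weightSpace I⟩ : weightSpace n lam) := by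
        ext
        simp only [Submodule.coe_sum, Submodule.coe_smul]
        conv_lhs => rw [← (tensorBasis N n).sum_repr v]
        simp only [tensorBasis_apply]
        rw [← Finset.sum_filter_of_ne (p := fun I : Fin n → Fin N =>
            ∀ j : Fin N, (Finset.univ.filter (fun s => I s = j)).card = lam j)]
        · exact Finset.sum_subtype _ (by simp) _
        · intro I _ hne
          by_contra hI
          rw [not_forall] at hI
          obtain ⟨i, hi⟩ := hI
          exact hne (by rw [repr_eq_zero_of_mem_weightSpace hv hi, zero_smul])
      rw [h]
      exact Submodule.sum_mem _ fun I _ => Submodule.smul_mem _ _ (Submodule.subset_span ⟨I, rfl⟩))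

theorem weightBasis_apply {N n : ℕ} {lam : Fin N → ℕ} (I : IndexSet n lam) :
    (weightBasis n lam I : TensorSpace N n) = basisVector I.1 := by
  simp [weightBasis]

/-- Vectors whose coordinates with respect to the `v_I` form an invertible matrix are a basis of the
weight subspace. -/
theorem exists_basis_of_det_ne_zero {N n : ℕ} {lam : Fin N → ℕ}
    (M : Matrix (IndexSet n lam) (IndexSet n lam) ℂ) (hM : M.det ≠ 0) :
    ∃ B : Module.Basis (IndexSet n lam) ℂ (weightSpace n lam),
      ∀ K, (B K : TensorSpace N n) = ∑ I, M K I • basisVector I.1 := by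
  have hM' : IsUnit M.transpose.det := by simpa using hM
  refine ⟨(weightBasis n lam).map (Matrix.toLinOfInv (weightBasis n lam) (weightBasis n lam)
    (Matrix.mul_nonsing_inv _ hM') (Matrix.nonsing_inv_mul _ hM')), fun K => ?_⟩
  rw [Module.Basis.map_apply, Matrix.toLinOfInv_apply, Matrix.toLin_self]
  simp [weightBasis_apply]

/-! ### Solutions of the Bethe equations near infinity -/

/-- The unknowns of the rescaled equations: the shift of the variable of level `i + 1` in the
cluster of the site `s` is stored at `⟨s, i⟩`, where `i + 1 ≤ I s`. -/
abbrev ClusterSpace {N n : ℕ} (I : Fin n → Fin N) : Type := (Σ s : Fin n, Fin (I s)) → ℂ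

/-- The shift of the variable of level `a` in the cluster of the site `s`, with the value `0` at
the level `0` and at the levels that do not occur in the cluster. -/
def shift {N n : ℕ} {I : Fin n → Fin N} (z : ClusterSpace I) : ℕ → Fin n → ℂ
  | 0, _ => 0
  | i + 1, s => if h : i < I s then z ⟨s, ⟨i, h⟩⟩ else 0

theorem shift_add_smul {N n : ℕ} {I : Fin n → Fin N} (z v : ClusterSpace I) (c : ℂ) (a : ℕ)
    (s : Fin n) : shift (z + c • v) a s = shift z a s + c * shift v a s := by
  cases a with
  | zero => simp [shift]
  | succ i => by_cases h : i < I s <;> simp [shift, h]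

theorem contDiff_shift {N n : ℕ} {I : Fin n → Fin N} (a : ℕ) (s : Fin n) {k : WithTop ℕ∞} :
    ContDiff ℂ k (fun z : ClusterSpace I => shift z a s) := by
  cases a with
  | zero => simpa [shift] using contDiff_const
  | succ i =>
    by_cases h : i < I s
    · simpa [shift, h] using contDiff_apply ℂ ℂ (⟨s, ⟨i, h⟩⟩ : Σ s : Fin n, Fin (I s))
    · simpa [shift, h] using contDiff_const

/-- The rescaled difference of the variable of level `a` at the site `s` and that of level `a'` at
the site `s'`, with `c` added. If `ε ≠ 0` and `t = ε⁻¹ b + shift`, it is `t - t' + c` when the sites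
are equal and `ε (t - t' + c)` otherwise. -/
def scaledDiff {N n : ℕ} {I : Fin n → Fin N} (b : Fin n → ℂ) (c : ℂ) (a : ℕ) (s : Fin n) (a' : ℕ)
    (s' : Fin n) (p : ℂ × ClusterSpace I) : ℂ :=
  (b s - b s') + (if s = s' then 1 else p.1) * (shift p.2 a s - shift p.2 a' s' + c)

theorem contDiff_scaledDiff {N n : ℕ} {I : Fin n → Fin N} (b : Fin n → ℂ) (c : ℂ) (a : ℕ)
    (s : Fin n) (a' : ℕ) (s' : Fin n) {k : WithTop ℕ∞} :
    ContDiff ℂ k (scaledDiff (I := I) b c a s a' s') := by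
  have h1 : ContDiff ℂ k (fun p : ℂ × ClusterSpace I => if s = s' then 1 else p.1) := by
    split_ifs
    · exact contDiff_const
    · exact contDiff_fst
  exact contDiff_const.add (h1.mul ((((contDiff_shift a s).comp contDiff_snd).sub
    ((contDiff_shift a' s').comp contDiff_snd)).add contDiff_const))

/-- The left hand side minus the right hand side of the rescaled Bethe equation for the variable of
level `i + 1` at the site `s`. -/
def scaledEquation {N n : ℕ} {I : Fin n → Fin N} (Q : ℕ → ℂ) (b : Fin n → ℂ) (i : ℕ) (s : Fin n)
    (p : ℂ × ClusterSpace I) : ℂ :=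
  Q i * (∏ s' ∈ upperSet I i, scaledDiff b 1 (i + 1) s i s' p)
      * (∏ s' ∈ (upperSet I (i + 1)).erase s, scaledDiff b (-1) (i + 1) s (i + 1) s' p)
      * (∏ s' ∈ upperSet I (i + 2), scaledDiff b 0 (i + 1) s (i + 2) s' p)
    - Q (i + 1) * (∏ s' ∈ upperSet I i, scaledDiff b 0 (i + 1) s i s' p)
      * (∏ s' ∈ (upperSet I (i + 1)).erase s, scaledDiff b 1 (i + 1) s (i + 1) s' p)
      * (∏ s' ∈ upperSet I (i + 2), scaledDiff b (-1) (i + 1) s (i + 2) s' p)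

/-- All rescaled Bethe equations. -/
def scaledSystem {N n : ℕ} {I : Fin n → Fin N} (Q : ℕ → ℂ) (b : Fin n → ℂ)
    (p : ℂ × ClusterSpace I) : ClusterSpace I :=
  fun k => scaledEquation Q b k.2 k.1 p

theorem contDiff_scaledSystem {N n : ℕ} {I : Fin n → Fin N} (Q : ℕ → ℂ) (b : Fin n → ℂ)
    {k : WithTop ℕ∞} : ContDiff ℂ k (scaledSystem (I := I) Q b) := by
  refine contDiff_pi.2 fun x => ?_
  have h : ∀ (T : Finset (Fin n)) (c : ℂ) (a : ℕ) (s : Fin n) (a' : ℕ),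
      ContDiff ℂ k (fun p : ℂ × ClusterSpace I => ∏ s' ∈ T, scaledDiff b c a s a' s' p) :=
    fun T c a s a' => contDiff_prod fun s' _ => contDiff_scaledDiff b c a s a' s'
  exact (((contDiff_const.mul (h _ _ _ _ _)).mul (h _ _ _ _ _)).mul (h _ _ _ _ _)).sub
    (((contDiff_const.mul (h _ _ _ _ _)).mul (h _ _ _ _ _)).mul (h _ _ _ _ _))

theorem mem_upperSet {N n : ℕ} {I : Fin n → Fin N} {a : ℕ} {s : Fin n} :
    s ∈ upperSet I a ↔ a ≤ I s := by
  simp [upperSet]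

theorem prod_scaledDiff_zero {N n : ℕ} {I : Fin n → Fin N} (b : Fin n → ℂ) (c : ℂ) (a : ℕ)
    (s : Fin n) (a' : ℕ) (T : Finset (Fin n)) (z : ClusterSpace I) :
    ∏ s' ∈ T, scaledDiff b c a s a' s' ((0 : ℂ), z) =
      (if s ∈ T then shift z a s - shift z a' s + c else 1) * ∏ s' ∈ T.erase s, (b s - b s') := by
  have h : ∏ s' ∈ T.erase s, scaledDiff b c a s a' s' ((0 : ℂ), z) =
      ∏ s' ∈ T.erase s, (b s - b s') := by
    refine Finset.prod_congr rfl fun s' hs' => ?_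
    simp [scaledDiff, Ne.symm (Finset.ne_of_mem_erase hs')]
  split_ifs with hs
  · rw [← Finset.mul_prod_erase T _ hs, h]
    simp [scaledDiff]
  · rw [one_mul, Finset.erase_eq_of_notMem hs] at *
    exact h

/-- The product of the leading terms of the factors that mix different clusters. -/
def clusterFactor {N n : ℕ} (I : Fin n → Fin N) (b : Fin n → ℂ) (i : ℕ) (s : Fin n) : ℂ :=
  (∏ s' ∈ (upperSet I i).erase s, (b s - b s'))
    * (∏ s' ∈ (upperSet I (i + 1)).erase s, (b s - b s'))
    * (∏ s' ∈ (upperSet I (i + 2)).erase s, (b s - b s'))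

theorem clusterFactor_ne_zero {N n : ℕ} (I : Fin n → Fin N) {b : Fin n → ℂ}
    (hb : Function.Injective b) (i : ℕ) (s : Fin n) : clusterFactor I b i s ≠ 0 := by
  have h : ∀ T : Finset (Fin n), ∏ s' ∈ T.erase s, (b s - b s') ≠ 0 := fun T =>
    Finset.prod_ne_zero_iff.2 fun s' hs' =>
      sub_ne_zero.2 fun h => Finset.ne_of_mem_erase hs' (hb h).symm
  exact mul_ne_zero (mul_ne_zero (h _) (h _)) (h _)

/-- In the limit `ε = 0` the clusters decouple, and each of them satisfies the Bethe equations of a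
single site. -/
theorem scaledEquation_zero {N n : ℕ} {I : Fin n → Fin N} (Q : ℕ → ℂ) (b : Fin n → ℂ) {i : ℕ}
    {s : Fin n} (hi : i < I s) (z : ClusterSpace I) :
    scaledEquation Q b i s ((0 : ℂ), z) = clusterFactor I b i s *
      (Q i * (shift z (i + 1) s - shift z i s + 1) *
          (if i + 1 < I s then shift z (i + 1) s - shift z (i + 2) s else 1)
        - Q (i + 1) * (shift z (i + 1) s - shift z i s) *
          (if i + 1 < I s then shift z (i + 1) s - shift z (i + 2) s - 1 else 1)) := by
  have h0 : s ∈ upperSet I i := mem_upperSet.2 hi.le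
  simp only [scaledEquation, prod_scaledDiff_zero, h0, if_true, Finset.notMem_erase, if_false,
    Finset.erase_idem, mem_upperSet, clusterFactor]
  have h2 : (i + 2 ≤ (I s : ℕ)) = (i + 1 < (I s : ℕ)) := rfl
  simp only [h2]
  split_ifs <;> ring

/-- The step `t^{(i + 1)} - t^{(i)}` of the solution for a single site in the part `m`, with
the parts and the values of `Q` numbered from `0`. -/
def baseStep (Q : ℕ → ℂ) (m i : ℕ) : ℂ := Q i / (Q m - Q i)

/-- The shifts at `ε = 0`. -/
def baseShift {N n : ℕ} (I : Fin n → Fin N) (Q : ℕ → ℂ) : ClusterSpace I :=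
  fun k => ∑ c ∈ Finset.range (k.2 + 1), baseStep Q (I k.1) c

theorem shift_baseShift {N n : ℕ} (I : Fin n → Fin N) (Q : ℕ → ℂ) {a : ℕ} {s : Fin n}
    (ha : a ≤ I s) :
    shift (baseShift I Q) a s = ∑ c ∈ Finset.range a, baseStep Q (I s) c := by
  cases a with
  | zero => simp [shift]
  | succ i => simp [shift, baseShift, Nat.lt_of_succ_le ha]

theorem shift_baseShift_sub {N n : ℕ} (I : Fin n → Fin N) (Q : ℕ → ℂ) {i : ℕ} {s : Fin n}
    (hi : i < I s) :
    shift (baseShift I Q) (i + 1) s - shift (baseShift I Q) i s = baseStep Q (I s) i := by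
  rw [shift_baseShift I Q hi, shift_baseShift I Q hi.le, Finset.sum_range_succ]
  ring

theorem scaledSystem_baseShift {N n : ℕ} (I : Fin n → Fin N) {Q : ℕ → ℂ} (b : Fin n → ℂ)
    (hQ : ∀ i j, i < j → j < N → Q i ≠ Q j) :
    scaledSystem Q b ((0 : ℂ), baseShift I Q) = 0 := by
  ext ⟨s, i, hi⟩
  rw [scaledSystem, scaledEquation_zero Q b hi, shift_baseShift_sub I Q hi]
  have h1 : Q (I s) - Q i ≠ 0 := sub_ne_zero.2 (hQ _ _ hi (I s).2).symm
  refine mul_eq_zero_of_right _ ?_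
  split_ifs with h
  · have h2 : Q (I s) - Q (i + 1) ≠ 0 := sub_ne_zero.2 (hQ _ _ h (I s).2).symm
    have h3 := shift_baseShift_sub I Q h
    rw [show shift (baseShift I Q) (i + 1) s - shift (baseShift I Q) (i + 2) s =
      -baseStep Q (I s) (i + 1) by rw [← h3]; ring]
    simp only [baseStep]
    field_simp
    ring
  · have h3 : (I s : ℕ) = i + 1 := by omega
    rw [h3] at h1 ⊢
    simp only [baseStep]
    field_simp
    ring

/-- A direction along which the derivative of the limit system vanishes is zero. The linearised
equations of a cluster are triangular with respect to the steps between consecutive levels. -/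
theorem eq_zero_of_hasDerivAt_scaledSystem {N n : ℕ} (I : Fin n → Fin N) {Q : ℕ → ℂ}
    {b : Fin n → ℂ} (hb : Function.Injective b) (hQ0 : ∀ i < N, Q i ≠ 0)
    (hQ : ∀ i j, i < j → j < N → Q i ≠ Q j) (v : ClusterSpace I)
    (hv : HasDerivAt (fun c : ℂ => scaledSystem Q b ((0 : ℂ), baseShift I Q + c • v)) 0 0) :
    v = 0 := by
  have hstep : ∀ s : Fin n, ∀ k i : ℕ, i + k + 1 = I s →
      shift v (i + 1) s - shift v i s = 0 := by
    intro s k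
    induction k with
    | zero =>
      intro i hi
      have his : i < I s := by omega
      have h1 : HasDerivAt (fun c : ℂ => scaledEquation Q b i s ((0 : ℂ), baseShift I Q + c • v))
          0 0 := (hasDerivAt_pi.1 hv) ⟨s, ⟨i, his⟩⟩
      simp only [scaledEquation_zero Q b his, shift_add_smul,
        show ¬ (i + 1 < (I s : ℕ)) by omega, if_false] at h1
      set w := shift v (i + 1) s - shift v i s with hw
      have h2 : HasDerivAt (fun c : ℂ => c * (clusterFactor I b i s * w * (Q i - Q (i + 1))) +
          clusterFactor I b i s * (Q i * (baseStep Q (I s) i + 1)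
            - Q (i + 1) * baseStep Q (I s) i))
          (1 * (clusterFactor I b i s * w * (Q i - Q (i + 1)))) 0 :=
        ((hasDerivAt_id (0 : ℂ)).mul_const _).add_const _
      have h3 := h1.unique (h2.congr_of_eventuallyEq (Filter.Eventually.of_forall fun c => by
        rw [← shift_baseShift_sub I Q his, hw]
        simp only
        ring))
      have h4 : Q i - Q (i + 1) ≠ 0 := sub_ne_zero.2 (hQ _ _ (by omega) (by omega))
      simpa [clusterFactor_ne_zero I hb, h4] using h3.symm
    | succ k ih =>
      intro i hi
      have his : i < I s := by omega
      have his' : i + 1 < I s := by omega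
      have h0 := ih (i + 1) (by omega)
      have h1 : HasDerivAt (fun c : ℂ => scaledEquation Q b i s ((0 : ℂ), baseShift I Q + c • v))
          0 0 := (hasDerivAt_pi.1 hv) ⟨s, ⟨i, his⟩⟩
      simp only [scaledEquation_zero Q b his, shift_add_smul, his', if_true] at h1
      set w := shift v (i + 1) s - shift v i s with hw
      set β := baseStep Q (I s) (i + 1) with hβ
      have h2 : HasDerivAt (fun c : ℂ => c * (clusterFactor I b i s * w *
            (Q (i + 1) * (β + 1) - Q i * β)) +
          clusterFactor I b i s * (Q i * (baseStep Q (I s) i + 1) * (-β)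
            - Q (i + 1) * baseStep Q (I s) i * (-β - 1)))
          (1 * (clusterFactor I b i s * w * (Q (i + 1) * (β + 1) - Q i * β))) 0 :=
        ((hasDerivAt_id (0 : ℂ)).mul_const _).add_const _
      have h3 := h1.unique (h2.congr_of_eventuallyEq (Filter.Eventually.of_forall fun c => by
        rw [← shift_baseShift_sub I Q his, hβ, ← shift_baseShift_sub I Q his', hw]
        rw [show shift v (i + 1 + 1) s = shift v (i + 1) s by linear_combination h0]
        simp only
        ring))
      have h4 : Q (i + 1) * (β + 1) - Q i * β ≠ 0 := by
        have h5 : Q (I s) - Q (i + 1) ≠ 0 := sub_ne_zero.2 (hQ _ _ his' (I s).2).symm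
        have h6 : Q (I s) - Q i ≠ 0 := sub_ne_zero.2 (hQ _ _ his (I s).2).symm
        have h7 : Q (i + 1) * (β + 1) - Q i * β =
            Q (i + 1) * (Q (I s) - Q i) / (Q (I s) - Q (i + 1)) := by
          rw [hβ, baseStep]
          field_simp
          ring
        rw [h7]
        exact div_ne_zero (mul_ne_zero (hQ0 _ (by omega)) h6) h5
      simpa [clusterFactor_ne_zero I hb, h4] using h3.symm
  have hshift : ∀ (s : Fin n) (a : ℕ), a ≤ I s → shift v a s = 0 := by
    intro s a
    induction a with
    | zero => intro _; rfl
    | succ a ih =>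
      intro ha
      have h := hstep s (I s - a - 1) a (by omega)
      rw [ih (by omega), sub_zero] at h
      exact h
  ext ⟨s, i, hi⟩
  have := hshift s (i + 1) hi
  simpa [shift, hi] using this

/-- The solution at `ε = 0` extends to small `ε`, by the implicit function theorem. -/
theorem exists_solution_scaledSystem {N n : ℕ} (I : Fin n → Fin N) {Q : ℕ → ℂ}
    {b : Fin n → ℂ} (hb : Function.Injective b) (hQ0 : ∀ i < N, Q i ≠ 0)
    (hQ : ∀ i j, i < j → j < N → Q i ≠ Q j) :
    ∃ z : ℂ → ClusterSpace I, Filter.Tendsto z (nhds 0) (nhds (baseShift I Q)) ∧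
      ∀ᶠ ε in nhds (0 : ℂ), scaledSystem Q b (ε, z ε) = 0 := by
  set u : ℂ × ClusterSpace I := (0, baseShift I Q) with hu
  have hF : ContDiffAt ℂ 1 (scaledSystem (I := I) Q b) u := (contDiff_scaledSystem Q b).contDiffAt
  have hinj : Function.Injective
      (fderiv ℂ (scaledSystem (I := I) Q b) u ∘L .inr ℂ ℂ (ClusterSpace I)) := by
    rw [injective_iff_map_eq_zero]
    intro v hv
    refine eq_zero_of_hasDerivAt_scaledSystem I hb hQ0 hQ v ?_
    have hd : HasDerivAt (fun c : ℂ => ((0 : ℂ), baseShift I Q + c • v)) ((0 : ℂ), v) 0 := by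
      refine (hasDerivAt_const _ _).prodMk ?_
      simpa using ((hasDerivAt_id (0 : ℂ)).smul_const v).const_add (baseShift I Q)
    have hc := HasFDerivAt.comp_hasDerivAt_of_eq (0 : ℂ)
      (hF.differentiableAt (by simp)).hasFDerivAt hd (by simp [hu])
    have hv' : fderiv ℂ (scaledSystem (I := I) Q b) u ((0 : ℂ), v) = 0 := by
      simpa using hv
    rw [hv'] at hc
    exact hc
  have hinv : (fderiv ℂ (scaledSystem (I := I) Q b) u ∘L
      .inr ℂ ℂ (ClusterSpace I)).IsInvertible := by
    refine ⟨(LinearEquiv.ofInjectiveEndo _ hinj).toContinuousLinearEquiv, ?_⟩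
    ext1 v
    rfl
  refine ⟨hF.implicitFunction one_ne_zero hinv, ?_, ?_⟩
  · have h1 := (hF.hasStrictFDerivAt_implicitFunction one_ne_zero hinv).continuousAt.tendsto
    rw [hF.implicitFunction_apply_self one_ne_zero hinv] at h1
    exact h1
  · have h1 := hF.eventually_apply_implicitFunction one_ne_zero hinv
    have h0 : scaledSystem Q b u = 0 := scaledSystem_baseShift I b hQ
    rw [h0] at h1
    exact h1

/-! ### Clusters of variables -/

theorem position_mem {N n : ℕ} {lam : Fin N → ℕ} (I : IndexSet n lam) (a : ℕ)
    (j : Fin (levelSize n lam a)) : position I a j ∈ upperSet I.1 a :=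
  Finset.orderEmbOfFin_mem _ _ _

theorem le_position {N n : ℕ} {lam : Fin N → ℕ} (I : IndexSet n lam) (a : ℕ)
    (j : Fin (levelSize n lam a)) : a ≤ I.1 (position I a j) :=
  mem_upperSet.1 (position_mem I a j)

theorem position_injective {N n : ℕ} {lam : Fin N → ℕ} (I : IndexSet n lam) (a : ℕ) :
    Function.Injective (position I a) :=
  ((upperSet I.1 a).orderEmbOfFin (card_upperSet I a)).injective

theorem exists_position_eq {N n : ℕ} {lam : Fin N → ℕ} (I : IndexSet n lam) {a : ℕ} {s : Fin n}
    (hs : a ≤ I.1 s) : ∃ j, position I a j = s := by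
  have h : s ∈ Set.range ((upperSet I.1 a).orderEmbOfFin (card_upperSet I a)) := by
    rw [Finset.range_orderEmbOfFin]
    exact mem_upperSet.2 hs
  exact h

theorem position_zero {N n : ℕ} {lam : Fin N → ℕ} (I : IndexSet n lam) (j : Fin n) :
    position I 0 j = j := by
  have h := Finset.orderEmbOfFin_unique (s := upperSet I.1 0) (card_upperSet I 0)
    (f := fun j : Fin n => j) (fun x => mem_upperSet.2 (Nat.zero_le _)) strictMono_id
  exact (congrFun h j).symm

theorem prod_position {N n : ℕ} {lam : Fin N → ℕ} (I : IndexSet n lam) (a : ℕ) (g : Fin n → ℂ) :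
    ∏ j, g (position I a j) = ∏ s ∈ upperSet I.1 a, g s := by
  refine Finset.prod_bij (fun j _ => position I a j) (fun j _ => position_mem I a j)
    (fun j _ j' _ h => position_injective I a h) (fun s hs => ?_) (fun _ _ => rfl)
  obtain ⟨j, hj⟩ := exists_position_eq I (mem_upperSet.1 hs)
  exact ⟨j, Finset.mem_univ _, hj⟩

theorem prod_erase_position {N n : ℕ} {lam : Fin N → ℕ} (I : IndexSet n lam) (a : ℕ)
    (j : Fin (levelSize n lam a)) (g : Fin n → ℂ) :
    ∏ j' ∈ Finset.univ.erase j, g (position I a j') =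
      ∏ s ∈ (upperSet I.1 a).erase (position I a j), g s := by
  refine Finset.prod_bij (fun j' _ => position I a j')
    (fun j' hj' => Finset.mem_erase.2 ⟨fun h => Finset.ne_of_mem_erase hj'
      (position_injective I a h), position_mem I a j'⟩)
    (fun j _ j' _ h => position_injective I a h) (fun s hs => ?_) (fun _ _ => rfl)
  obtain ⟨j', rfl⟩ := exists_position_eq I (mem_upperSet.1 (Finset.mem_of_mem_erase hs))
  exact ⟨j', Finset.mem_erase.2 ⟨fun h => Finset.ne_of_mem_erase hs (by rw [h]),
    Finset.mem_univ _⟩, rfl⟩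

/-- The variable of level `a` in the cluster of the site `s`, for the inhomogeneities `ε⁻¹ b`. -/
def clusterVar {N n : ℕ} {I : Fin n → Fin N} (b : Fin n → ℂ) (ε : ℂ) (z : ClusterSpace I) (a : ℕ)
    (s : Fin n) : ℂ :=
  ε⁻¹ * b s + shift z a s

/-- The point whose group `t^{(a)}` consists of the variables of level `a` of the clusters of the
sites `i^{(a)}_1 < ⋯ < i^{(a)}_{l_a}`. -/
def clusterPoint {N n : ℕ} {lam : Fin N → ℕ} (I : IndexSet n lam) (b : Fin n → ℂ) (ε : ℂ)
    (z : ClusterSpace I.1) : Variables n lam :=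
  fun a j => clusterVar b ε z (a + 1) (position I (a + 1) j)

theorem lt_of_fin_levelSize {N n : ℕ} {lam : Fin N → ℕ} (I : IndexSet n lam) {a : ℕ}
    (j : Fin (levelSize n lam (a + 1))) : a < N - 1 := by
  have h1 := le_position I (a + 1) j
  have h2 := (I.1 (position I (a + 1) j)).2
  omega

theorem groups_clusterPoint {N n : ℕ} {lam : Fin N → ℕ} (I : IndexSet n lam) (b : Fin n → ℂ)
    (ε : ℂ) (z : ClusterSpace I.1) (a : ℕ) (j : Fin (levelSize n lam a)) :
    groups (fun s => ε⁻¹ * b s) (clusterPoint I b ε z) a j =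
      clusterVar b ε z a (position I a j) := by
  cases a with
  | zero =>
    have h : b j = b (position I 0 j) := congrArg b (position_zero I j).symm
    simp [groups, clusterVar, shift, h]
  | succ a => simp [groups, clusterPoint, lt_of_fin_levelSize I j]

theorem scaledDiff_eq {N n : ℕ} {I : Fin n → Fin N} (b : Fin n → ℂ) (c : ℂ) (a : ℕ) (s : Fin n)
    (a' : ℕ) (s' : Fin n) {ε : ℂ} (hε : ε ≠ 0) (z : ClusterSpace I) :
    scaledDiff b c a s a' s' (ε, z) =
      (if s = s' then 1 else ε) * (clusterVar b ε z a s - clusterVar b ε z a' s' + c) := by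
  by_cases h : s = s'
  · subst h
    simp [scaledDiff, clusterVar]
  · simp only [scaledDiff, clusterVar, h, if_false]
    field_simp
    ring

/-- The values `q_i`, indexed by all natural numbers. -/
def extendByZero {N : ℕ} (q : Fin N → ℂ) (i : ℕ) : ℂ := if h : i < N then q ⟨i, h⟩ else 0

theorem isBetheSolution_clusterPoint {N n : ℕ} {lam : Fin N → ℕ} (I : IndexSet n lam)
    (q : Fin N → ℂ) (b : Fin n → ℂ) {ε : ℂ} (hε : ε ≠ 0) {z : ClusterSpace I.1}
    (hz : scaledSystem (extendByZero q) b (ε, z) = 0) :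
    IsBetheSolution q (fun s => ε⁻¹ * b s) (clusterPoint I b ε z) := by
  intro a ha j
  set s := position I (a + 1) j with hs
  have h := congrFun hz ⟨s, ⟨a, le_position I (a + 1) j⟩⟩
  have hprod : ∀ (c : ℂ) (a' : ℕ),
      ∏ j', (groups (fun s => ε⁻¹ * b s) (clusterPoint I b ε z) (a + 1) j
        - groups (fun s => ε⁻¹ * b s) (clusterPoint I b ε z) a' j' + c) =
      ∏ s' ∈ upperSet I.1 a', (clusterVar b ε z (a + 1) s - clusterVar b ε z a' s' + c) := by
    intro c a'
    simp only [groups_clusterPoint]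
    exact prod_position I a' fun s' => clusterVar b ε z (a + 1) s - clusterVar b ε z a' s' + c
  have hprod_erase : ∀ c : ℂ, ∏ j' ∈ Finset.univ.erase j,
      (groups (fun s => ε⁻¹ * b s) (clusterPoint I b ε z) (a + 1) j
        - groups (fun s => ε⁻¹ * b s) (clusterPoint I b ε z) (a + 1) j' + c) =
      ∏ s' ∈ (upperSet I.1 (a + 1)).erase s,
        (clusterVar b ε z (a + 1) s - clusterVar b ε z (a + 1) s' + c) := by
    intro c
    simp only [groups_clusterPoint]
    exact prod_erase_position I (a + 1) j
      fun s' => clusterVar b ε z (a + 1) s - clusterVar b ε z (a + 1) s' + c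
  have e1 := hprod 1 a
  have e2 := hprod_erase (-1)
  have e3 := hprod 0 (a + 2)
  have e4 := hprod 0 a
  have e5 := hprod_erase 1
  have e6 := hprod (-1) (a + 2)
  simp only [← sub_eq_add_neg, add_zero] at e1 e2 e3 e4 e5 e6
  rw [e1, e2, e3, e4, e5, e6]
  simp only [scaledSystem, scaledEquation, scaledDiff_eq b _ _ _ _ _ hε,
    Finset.prod_mul_distrib, ← sub_eq_add_neg, add_zero, Pi.zero_apply] at h
  -- the powers of `ε` on the two sides agree
  have hne : ∀ T : Finset (Fin n), ∏ s' ∈ T, (if s = s' then (1 : ℂ) else ε) ≠ 0 := fun T =>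
    Finset.prod_ne_zero_iff.2 fun s' _ => by split_ifs <;> simp [hε]
  have hq1 : extendByZero q a = q ⟨a, Nat.lt_of_succ_lt ha⟩ := dif_pos _
  have hq2 : extendByZero q (a + 1) = q ⟨a + 1, ha⟩ := dif_pos _
  rw [hq1, hq2] at h
  refine mul_left_cancel₀ (mul_ne_zero (mul_ne_zero (hne (upperSet I.1 a))
    (hne ((upperSet I.1 (a + 1)).erase s))) (hne (upperSet I.1 (a + 2)))) ?_
  linear_combination h

theorem tendsto_scaledDiff {N n : ℕ} {I : Fin n → Fin N} {z : ℂ → ClusterSpace I}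
    {z₀ : ClusterSpace I} (hz : Filter.Tendsto z (nhds 0) (nhds z₀)) (b : Fin n → ℂ) (c : ℂ)
    (a : ℕ) (s : Fin n) (a' : ℕ) (s' : Fin n) :
    Filter.Tendsto (fun ε => scaledDiff b c a s a' s' (ε, z ε)) (nhdsWithin 0 {0}ᶜ)
      (nhds (scaledDiff b c a s a' s' (0, z₀))) := by
  have h := (contDiff_scaledDiff (I := I) b c a s a' s' (k := 0)).continuous.tendsto (0, z₀)
  exact (h.comp (Filter.tendsto_id.prodMk_nhds hz)).mono_left nhdsWithin_le_nhds

theorem eventually_clusterVar_ne {N n : ℕ} {I : Fin n → Fin N} {z : ℂ → ClusterSpace I}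
    {z₀ : ClusterSpace I} (hz : Filter.Tendsto z (nhds 0) (nhds z₀)) (b : Fin n → ℂ)
    {a : ℕ} {s : Fin n} {a' : ℕ} {s' : Fin n}
    (hne : scaledDiff b 0 a s a' s' (0, z₀) ≠ 0) :
    ∀ᶠ ε in nhdsWithin (0 : ℂ) {0}ᶜ, clusterVar b ε (z ε) a s ≠ clusterVar b ε (z ε) a' s' := by
  filter_upwards [(tendsto_scaledDiff hz b 0 a s a' s').eventually_ne hne, self_mem_nhdsWithin]
    with ε h1 hε h2
  rw [scaledDiff_eq b _ _ _ _ _ hε, h2] at h1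
  simp at h1

theorem scaledDiff_zero_ne_zero {N n : ℕ} {I : Fin n → Fin N} {b : Fin n → ℂ}
    (hb : Function.Injective b) (c : ℂ) (a a' : ℕ) {s s' : Fin n} (hs : s ≠ s')
    (z : ClusterSpace I) : scaledDiff b c a s a' s' ((0 : ℂ), z) ≠ 0 := by
  simpa [scaledDiff, hs, sub_eq_zero] using fun h => hs (hb h)

theorem eventually_isOffDiagonal_clusterPoint {N n : ℕ} {lam : Fin N → ℕ} (I : IndexSet n lam)
    {Q : ℕ → ℂ} {b : Fin n → ℂ} (hb : Function.Injective b) (hQ0 : ∀ i < N, Q i ≠ 0)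
    (hQ : ∀ i j, i < j → j < N → Q i ≠ Q j) {z : ℂ → ClusterSpace I.1}
    (hz : Filter.Tendsto z (nhds 0) (nhds (baseShift I.1 Q))) :
    ∀ᶠ ε in nhdsWithin (0 : ℂ) {0}ᶜ, IsOffDiagonal (clusterPoint I b ε (z ε)) := by
  refine Filter.Eventually.and ?_ ?_
  · simp only [Filter.eventually_all]
    intro a j j' hjj
    exact eventually_clusterVar_ne hz b (scaledDiff_zero_ne_zero hb _ _ _
      (fun h => hjj.ne (position_injective I _ h)) _)
  · simp only [Filter.eventually_all]
    intro a a' haa j j'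
    refine eventually_clusterVar_ne hz b ?_
    by_cases hs : position I (a + 1) j = position I (a' + 1) j'
    · have hI := le_position I (a' + 1) j'
      rw [← hs] at hI ⊢
      rw [haa] at hI ⊢
      have h1 := shift_baseShift_sub I.1 Q (i := a + 1) (s := position I (a + 1) j) hI
      have h2 : baseStep Q (I.1 (position I (a + 1) j)) (a + 1) ≠ 0 :=
        div_ne_zero (hQ0 _ (by omega)) (sub_ne_zero.2 (hQ _ _ hI (Fin.is_lt _)).symm)
      rw [← h1] at h2
      intro h
      simp only [scaledDiff, sub_self, if_true, zero_add, one_mul, add_zero] at h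
      exact h2 (by linear_combination -h)
    · exact scaledDiff_zero_ne_zero hb _ _ _ hs _

/-- Each decomposition `I` labels a family of off-diagonal solutions for the inhomogeneities
`ε⁻¹ b`, `ε → 0`, whose variables form bounded clusters around the sites. -/
theorem exists_cluster_solution {N n : ℕ} {lam : Fin N → ℕ} (I : IndexSet n lam) {q : Fin N → ℂ}
    (hq0 : ∀ i, q i ≠ 0) (hq : Function.Injective q) {b : Fin n → ℂ}
    (hb : Function.Injective b) :
    ∃ (z : ℂ → ClusterSpace I.1) (z₀ : ClusterSpace I.1), Filter.Tendsto z (nhds 0) (nhds z₀) ∧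
      ∀ᶠ ε in nhdsWithin (0 : ℂ) {0}ᶜ,
        IsBetheSolution q (fun s => ε⁻¹ * b s) (clusterPoint I b ε (z ε)) ∧
          IsOffDiagonal (clusterPoint I b ε (z ε)) := by
  have hQ0 : ∀ i < N, extendByZero q i ≠ 0 := fun i hi => by
    simpa [extendByZero, hi] using hq0 _
  have hQ : ∀ i j, i < j → j < N → extendByZero q i ≠ extendByZero q j := by
    intro i j hij hj h
    simp only [extendByZero, hj, hij.trans hj, dif_pos] at h
    have := hq h
    simp only [Fin.mk.injEq] at this
    omega
  obtain ⟨z, hz, hsol⟩ := exists_solution_scaledSystem I.1 hb hQ0 hQ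
  refine ⟨z, _, hz, ?_⟩
  filter_upwards [hsol.filter_mono nhdsWithin_le_nhds, self_mem_nhdsWithin,
    eventually_isOffDiagonal_clusterPoint I hb hQ0 hQ hz] with ε h1 hε h2
  exact ⟨isBetheSolution_clusterPoint I q b hε h1, h2⟩

/-! ### Asymptotics of the Bethe vectors -/

/-- The site whose cluster supplies the variable `t^{(a)}_j` of the point `clusterPoint I` after the
permutations `σ`. -/
def siteOf {N n : ℕ} {lam : Fin N → ℕ} (I : IndexSet n lam)
    (σ : (a : Fin (N - 1)) → Equiv.Perm (Fin (levelSize n lam (a + 1)))) :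
    (a : ℕ) → Fin (levelSize n lam a) → Fin n
  | 0 => fun j => j
  | a + 1 => fun j => position I (a + 1) (if h : a < N - 1 then σ ⟨a, h⟩ j else j)

theorem siteOf_succ {N n : ℕ} {lam : Fin N → ℕ} (I : IndexSet n lam)
    (σ : (a : Fin (N - 1)) → Equiv.Perm (Fin (levelSize n lam (a + 1)))) (a : Fin (N - 1))
    (j : Fin (levelSize n lam (a + 1))) : siteOf I σ (a + 1) j = position I (a + 1) (σ a j) := by
  simp [siteOf]

theorem groups_permuted_clusterPoint {N n : ℕ} {lam : Fin N → ℕ} (I : IndexSet n lam)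
    (σ : (a : Fin (N - 1)) → Equiv.Perm (Fin (levelSize n lam (a + 1)))) (b : Fin n → ℂ)
    (ε : ℂ) (z : ClusterSpace I.1) (a : ℕ) (j : Fin (levelSize n lam a)) :
    groups (fun s => ε⁻¹ * b s) (fun a j => clusterPoint I b ε z a (σ a j)) a j =
      clusterVar b ε z a (siteOf I σ a j) := by
  cases a with
  | zero => simp [groups, clusterVar, shift, siteOf]
  | succ a => simp [groups, clusterPoint, lt_of_fin_levelSize I j, siteOf]

theorem tendsto_mul_clusterVar_sub {N n : ℕ} {I : Fin n → Fin N} {z : ℂ → ClusterSpace I}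
    {z₀ : ClusterSpace I} (hz : Filter.Tendsto z (nhds 0) (nhds z₀)) (b : Fin n → ℂ) (c : ℂ)
    (a : ℕ) (s : Fin n) (a' : ℕ) (s' : Fin n) :
    Filter.Tendsto (fun ε => ε * (clusterVar b ε (z ε) a s - clusterVar b ε (z ε) a' s' + c))
      (nhdsWithin 0 {0}ᶜ) (nhds (b s - b s')) := by
  have hsh : ∀ (a : ℕ) (s : Fin n),
      Filter.Tendsto (fun ε => shift (z ε) a s) (nhds 0) (nhds (shift z₀ a s)) := fun a s =>
    ((contDiff_shift (I := I) a s (k := 0)).continuous.tendsto z₀).comp hz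
  have h1 : Filter.Tendsto (fun ε : ℂ => (b s - b s') +
      ε * (shift (z ε) a s - shift (z ε) a' s' + c)) (nhdsWithin 0 {0}ᶜ) (nhds (b s - b s')) := by
    have := (tendsto_const_nhds (x := b s - b s')).add ((Filter.tendsto_id (x := nhds (0 : ℂ))).mul
      (((hsh a s).sub (hsh a' s')).add (tendsto_const_nhds (x := c))))
    simp only [id, zero_mul, add_zero] at this
    exact this.mono_left nhdsWithin_le_nhds
  refine h1.congr' ?_
  filter_upwards [self_mem_nhdsWithin] with ε hε
  have hε' : ε ≠ 0 := hε
  simp only [clusterVar]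
  field_simp
  ring

theorem tendsto_clusterVar_ratio {N n : ℕ} {I : Fin n → Fin N} {z : ℂ → ClusterSpace I}
    {z₀ : ClusterSpace I} (hz : Filter.Tendsto z (nhds 0) (nhds z₀)) {b : Fin n → ℂ}
    (hb : Function.Injective b) (a : ℕ) {s s' : Fin n} (hs : s ≠ s') :
    Filter.Tendsto (fun ε => (clusterVar b ε (z ε) a s - clusterVar b ε (z ε) a s' + 1) /
      (clusterVar b ε (z ε) a s - clusterVar b ε (z ε) a s'))
      (nhdsWithin 0 {0}ᶜ) (nhds 1) := by
  have hne : b s - b s' ≠ 0 := sub_ne_zero.2 fun h => hs (hb h)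
  have h := (tendsto_mul_clusterVar_sub hz b 1 a s a s').div
    (tendsto_mul_clusterVar_sub hz b 0 a s a s') hne
  rw [div_self hne] at h
  refine h.congr' ?_
  filter_upwards [self_mem_nhdsWithin] with ε hε
  have hε' : ε ≠ 0 := hε
  simp only [Pi.div_apply, add_zero]
  exact mul_div_mul_left _ _ hε'

/-- The number of the factors of `U_J`, outside the quotients, that are of the order of `ε⁻¹` at a
generic point of this size. It does not depend on the permutations. -/
def weightDegree {N n : ℕ} {lam : Fin N → ℕ} (J : IndexSet n lam) : ℕ :=
  ∑ a : Fin (N - 1), ∑ j : Fin (levelSize n lam (a + 1)),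
    ((Finset.univ.filter (fun j' : Fin (levelSize n lam a) =>
        position J a j' < position J (a + 1) j)).card
      + (Finset.univ.filter (fun j' : Fin (levelSize n lam a) =>
        position J (a + 1) j < position J a j')).card)

/-- The leading coefficient of the summand of `W_J` for the permutations `σ` at the point
`clusterPoint I`. -/
def leadingU {N n : ℕ} {lam : Fin N → ℕ} (I J : IndexSet n lam) (b : Fin n → ℂ)
    (σ : (a : Fin (N - 1)) → Equiv.Perm (Fin (levelSize n lam (a + 1)))) : ℂ :=
  ∏ a : Fin (N - 1), ∏ j : Fin (levelSize n lam (a + 1)),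
    ((∏ j' ∈ Finset.univ.filter (fun j' : Fin (levelSize n lam a) =>
          position J a j' < position J (a + 1) j),
        (b (siteOf I σ (a + 1) j) - b (siteOf I σ a j')))
      * (∏ j' ∈ Finset.univ.filter (fun j' : Fin (levelSize n lam a) =>
          position J (a + 1) j < position J a j'),
        (b (siteOf I σ (a + 1) j) - b (siteOf I σ a j'))))

theorem tendsto_weightU {N n : ℕ} {lam : Fin N → ℕ} (I J : IndexSet n lam) {b : Fin n → ℂ}
    (hb : Function.Injective b) {z : ℂ → ClusterSpace I.1} {z₀ : ClusterSpace I.1}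
    (hz : Filter.Tendsto z (nhds 0) (nhds z₀))
    (σ : (a : Fin (N - 1)) → Equiv.Perm (Fin (levelSize n lam (a + 1)))) :
    Filter.Tendsto (fun ε => ε ^ weightDegree J *
      weightU J (fun a j => clusterPoint I b ε (z ε) a (σ a j)) (fun s => ε⁻¹ * b s))
      (nhdsWithin 0 {0}ᶜ) (nhds (leadingU I J b σ)) := by
  have hpow : ∀ ε : ℂ, ε ^ weightDegree J *
      weightU J (fun a j => clusterPoint I b ε (z ε) a (σ a j)) (fun s => ε⁻¹ * b s) =
      ∏ a : Fin (N - 1), ∏ j : Fin (levelSize n lam (a + 1)),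
        ((∏ j' ∈ Finset.univ.filter (fun j' : Fin (levelSize n lam a) =>
            position J a j' < position J (a + 1) j),
          ε * (clusterVar b ε (z ε) (a + 1) (siteOf I σ (a + 1) j)
            - clusterVar b ε (z ε) a (siteOf I σ a j') + 1))
        * (∏ j' ∈ Finset.univ.filter (fun j' : Fin (levelSize n lam a) =>
            position J (a + 1) j < position J a j'),
          ε * (clusterVar b ε (z ε) (a + 1) (siteOf I σ (a + 1) j)
            - clusterVar b ε (z ε) a (siteOf I σ a j') + 0))
        * (∏ j' ∈ Finset.univ.filter (fun j' : Fin (levelSize n lam (a + 1)) => j < j'),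
          (clusterVar b ε (z ε) (a + 1) (siteOf I σ (a + 1) j)
            - clusterVar b ε (z ε) (a + 1) (siteOf I σ (a + 1) j') + 1)
          / (clusterVar b ε (z ε) (a + 1) (siteOf I σ (a + 1) j)
            - clusterVar b ε (z ε) (a + 1) (siteOf I σ (a + 1) j')))) := by
    intro ε
    simp only [weightDegree, weightU, ← Finset.prod_pow_eq_pow_sum, ← Finset.prod_mul_distrib]
    refine Finset.prod_congr rfl fun a _ => Finset.prod_congr rfl fun j _ => ?_
    simp only [groups_permuted_clusterPoint]
    simp only [clusterPoint, Finset.prod_mul_distrib, Finset.prod_const, add_zero, pow_add,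
      siteOf_succ]
    ring
  simp only [hpow]
  have hone : leadingU I J b σ = ∏ a : Fin (N - 1), ∏ j : Fin (levelSize n lam (a + 1)),
      ((∏ j' ∈ Finset.univ.filter (fun j' : Fin (levelSize n lam a) =>
          position J a j' < position J (a + 1) j),
        (b (siteOf I σ (a + 1) j) - b (siteOf I σ a j')))
      * (∏ j' ∈ Finset.univ.filter (fun j' : Fin (levelSize n lam a) =>
          position J (a + 1) j < position J a j'),
        (b (siteOf I σ (a + 1) j) - b (siteOf I σ a j')))
      * (∏ j' ∈ Finset.univ.filter (fun j' : Fin (levelSize n lam (a + 1)) => j < j'), 1)) := by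
    simp [leadingU]
  rw [hone]
  refine tendsto_finsetProd _ fun a _ => tendsto_finsetProd _ fun j _ => ?_
  refine Filter.Tendsto.mul (Filter.Tendsto.mul ?_ ?_) ?_
  · exact tendsto_finsetProd _ fun j' _ => tendsto_mul_clusterVar_sub hz b 1 _ _ _ _
  · exact tendsto_finsetProd _ fun j' _ => tendsto_mul_clusterVar_sub hz b 0 _ _ _ _
  · refine tendsto_finsetProd _ fun j' hj' => tendsto_clusterVar_ratio hz hb _ ?_
    rw [siteOf_succ, siteOf_succ]
    exact fun h => (Finset.mem_filter.1 hj').2.ne ((σ a).injective (position_injective I _ h))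

theorem leadingU_ne_zero_iff {N n : ℕ} {lam : Fin N → ℕ} (I J : IndexSet n lam) {b : Fin n → ℂ}
    (hb : Function.Injective b)
    (σ : (a : Fin (N - 1)) → Equiv.Perm (Fin (levelSize n lam (a + 1)))) :
    leadingU I J b σ ≠ 0 ↔ ∀ (a : Fin (N - 1)) (j : Fin (levelSize n lam (a + 1)))
      (j' : Fin (levelSize n lam a)), position J (a + 1) j ≠ position J a j' →
        siteOf I σ (a + 1) j ≠ siteOf I σ a j' := by
  simp only [leadingU, Finset.prod_ne_zero_iff, mul_ne_zero_iff, Finset.mem_univ, true_imp_iff,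
    Finset.mem_filter, true_and, sub_ne_zero, hb.ne_iff]
  refine forall_congr' fun a => forall_congr' fun j => ⟨fun h j' hne => ?_, fun h => ?_⟩
  · rcases lt_or_gt_of_ne hne with hlt | hlt
    · exact h.2 j' hlt
    · exact h.1 j' hlt
  · exact ⟨fun j' hlt => h j' hlt.ne', fun j' hlt => h j' hlt.ne⟩

/-- If the leading coefficient does not vanish, then at each level every variable comes from the
cluster of its own position: by induction on the level, the variable of the previous level in the
same cluster has to sit at the same position. -/
theorem siteOf_eq_position {N n : ℕ} {lam : Fin N → ℕ} {I J : IndexSet n lam} {b : Fin n → ℂ}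
    (hb : Function.Injective b)
    {σ : (a : Fin (N - 1)) → Equiv.Perm (Fin (levelSize n lam (a + 1)))}
    (h : leadingU I J b σ ≠ 0) (a : ℕ) (j : Fin (levelSize n lam a)) :
    siteOf I σ a j = position J a j := by
  rw [leadingU_ne_zero_iff I J hb] at h
  induction a with
  | zero => exact (position_zero J j).symm
  | succ a ih =>
    have ha := lt_of_fin_levelSize I j
    have hsurj : ∃ j', siteOf I σ a j' = siteOf I σ (a + 1) j := by
      cases a with
      | zero => exact ⟨_, rfl⟩
      | succ a =>
        have ha' : a < N - 1 := by omega
        have hle : a + 1 ≤ (I.1 (siteOf I σ (a + 1 + 1) j) : ℕ) :=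
          (Nat.le_succ _).trans (le_position I (a + 1 + 1) _)
        obtain ⟨k, hk⟩ := exists_position_eq I hle
        refine ⟨(σ ⟨a, ha'⟩).symm k, ?_⟩
        rw [← hk, siteOf_succ I σ ⟨a, ha'⟩]
        simp
    obtain ⟨j', hj'⟩ := hsurj
    rw [← hj', ih j']
    by_contra hne
    exact h ⟨a, ha⟩ j j' (Ne.symm hne) hj'.symm

theorem leadingU_one_ne_zero {N n : ℕ} {lam : Fin N → ℕ} (I : IndexSet n lam) {b : Fin n → ℂ}
    (hb : Function.Injective b) : leadingU I I b 1 ≠ 0 := by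
  rw [leadingU_ne_zero_iff I I hb]
  intro a j j' hne
  have h : ∀ (a : ℕ) (j : Fin (levelSize n lam a)), siteOf I 1 a j = position I a j := by
    intro a j
    cases a with
    | zero => exact (position_zero I j).symm
    | succ a => simp [siteOf]
  rwa [h, h]

theorem eq_of_leadingU_ne_zero {N n : ℕ} {lam : Fin N → ℕ} {I J : IndexSet n lam} {b : Fin n → ℂ}
    (hb : Function.Injective b)
    {σ : (a : Fin (N - 1)) → Equiv.Perm (Fin (levelSize n lam (a + 1)))}
    (h : leadingU I J b σ ≠ 0) : I = J ∧ σ = 1 := by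
  have hsite := siteOf_eq_position hb h
  have hle : ∀ s, (J.1 s : ℕ) ≤ I.1 s := by
    intro s
    rcases Nat.eq_zero_or_pos (J.1 s : ℕ) with h0 | h0
    · omega
    · obtain ⟨a, ha⟩ := Nat.exists_eq_succ_of_ne_zero h0.ne'
      obtain ⟨j, rfl⟩ := exists_position_eq J ha.ge
      rw [ha, ← hsite]
      exact le_position I (a + 1) _
  have hge : ∀ s, (I.1 s : ℕ) ≤ J.1 s := by
    intro s
    rcases Nat.eq_zero_or_pos (I.1 s : ℕ) with h0 | h0
    · omega
    · obtain ⟨a, ha⟩ := Nat.exists_eq_succ_of_ne_zero h0.ne'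
      have haN : a < N - 1 := by have := (I.1 s).2; omega
      obtain ⟨j, rfl⟩ := exists_position_eq I ha.ge
      have h1 := hsite (a + 1) ((σ ⟨a, haN⟩).symm j)
      rw [siteOf_succ I σ ⟨a, haN⟩, Equiv.apply_symm_apply] at h1
      rw [ha]
      simp only at h1
      rw [h1]
      exact le_position J (a + 1) _
  obtain rfl : I = J := Subtype.ext (funext fun s => Fin.ext (le_antisymm (hge s) (hle s)))
  refine ⟨rfl, funext fun a => Equiv.ext fun j => ?_⟩
  have h1 := hsite (a + 1) j
  rw [siteOf_succ] at h1
  exact position_injective I _ h1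

/-- The matrix of the coordinates of the Bethe vectors of the cluster solutions is asymptotically
diagonal after rescaling its columns. -/
theorem eventually_det_weightW_ne_zero {N n : ℕ} {lam : Fin N → ℕ} {b : Fin n → ℂ}
    (hb : Function.Injective b) {z : (I : IndexSet n lam) → ℂ → ClusterSpace I.1}
    {z₀ : (I : IndexSet n lam) → ClusterSpace I.1}
    (hz : ∀ I, Filter.Tendsto (z I) (nhds 0) (nhds (z₀ I))) :
    ∀ᶠ ε in nhdsWithin (0 : ℂ) {0}ᶜ, (Matrix.of fun I J : IndexSet n lam =>
      weightW J (clusterPoint I b ε (z I ε)) (fun s => ε⁻¹ * b s)).det ≠ 0 := by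
  have hlim : Filter.Tendsto (fun ε => Matrix.of fun I J : IndexSet n lam => ε ^ weightDegree J *
      weightW J (clusterPoint I b ε (z I ε)) (fun s => ε⁻¹ * b s)) (nhdsWithin 0 {0}ᶜ)
      (nhds (Matrix.diagonal fun I : IndexSet n lam => leadingU I I b 1)) := by
    refine tendsto_pi_nhds.2 fun I => tendsto_pi_nhds.2 fun J => ?_
    have h1 : (Matrix.diagonal fun I : IndexSet n lam => leadingU I I b 1) I J =
        ∑ σ, leadingU I J b σ := by
      by_cases hIJ : I = J
      · subst hIJ
        rw [Matrix.diagonal_apply_eq, Finset.sum_eq_single 1]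
        · intro σ _ hσ
          by_contra h
          exact hσ (eq_of_leadingU_ne_zero hb h).2
        · simp
      · rw [Matrix.diagonal_apply_ne _ hIJ]
        refine (Finset.sum_eq_zero fun σ _ => ?_).symm
        by_contra h
        exact hIJ (eq_of_leadingU_ne_zero hb h).1
    rw [h1]
    simp only [Matrix.of_apply, weightW, Finset.mul_sum]
    exact tendsto_finsetSum _ fun σ _ => tendsto_weightU I J hb (hz I) σ
  have hdet := (continuous_id.matrix_det.tendsto _).comp hlim
  have hne : (Matrix.diagonal fun I : IndexSet n lam => leadingU I I b 1).det ≠ 0 := by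
    rw [Matrix.det_diagonal]
    exact Finset.prod_ne_zero_iff.2 fun I _ => leadingU_one_ne_zero I hb
  filter_upwards [hdet.eventually_ne hne] with ε hε h0
  refine hε ?_
  simp only [Function.comp_apply, id]
  have := Matrix.det_mul_row (fun J : IndexSet n lam => ε ^ weightDegree J)
    (Matrix.of fun I J : IndexSet n lam =>
      weightW J (clusterPoint I b ε (z I ε)) (fun s => ε⁻¹ * b s))
  rw [h0, mul_zero] at this
  exact this

/-! ### Genericity -/

theorem groups_mem_polyFun {ι : Type*} {N n : ℕ} {lam : Fin N → ℕ} {b : (ι → ℂ) → Fin n → ℂ}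
    {t : (ι → ℂ) → Variables n lam} (hb : ∀ s, (fun y => b y s) ∈ polyFun ι)
    (ht : ∀ a j, (fun y => t y a j) ∈ polyFun ι) (a : ℕ) (j : Fin (levelSize n lam a)) :
    (fun y => groups (b y) (t y) a j) ∈ polyFun ι := by
  cases a with
  | zero => exact hb j
  | succ a =>
    by_cases h : a < N - 1
    · simpa [groups, h] using ht ⟨a, h⟩ j
    · simpa [groups, h] using const_mem_polyFun 0

theorem isAlgebraicCondition_isBetheSolution {ι : Type*} {N n : ℕ} {lam : Fin N → ℕ}
    (q : Fin N → ℂ) {b : (ι → ℂ) → Fin n → ℂ} {t : (ι → ℂ) → Variables n lam}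
    (hb : ∀ s, (fun y => b y s) ∈ polyFun ι) (ht : ∀ a j, (fun y => t y a j) ∈ polyFun ι) :
    IsAlgebraicCondition fun y => IsBetheSolution q (b y) (t y) := by
  have hd : ∀ a a' j j', (fun y => groups (b y) (t y) a j - groups (b y) (t y) a' j') ∈ polyFun ι :=
    fun a a' j j' => fun_sub_mem_polyFun (groups_mem_polyFun hb ht a j)
      (groups_mem_polyFun hb ht a' j')
  refine .forall fun a => .forall fun ha => .forall fun j => .of_eq ?_ ?_
  all_goals
    refine fun_mul_mem_polyFun (fun_mul_mem_polyFun (fun_mul_mem_polyFun (const_mem_polyFun _)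
      ?_) ?_) ?_
    all_goals
      refine fun_prod_mem_polyFun _ fun j' _ => ?_
      first
        | exact hd _ _ _ _
        | exact fun_add_mem_polyFun (hd _ _ _ _) (const_mem_polyFun 1)
        | exact fun_sub_mem_polyFun (hd _ _ _ _) (const_mem_polyFun 1)

/-- The positions `(a, j)` of the variables `t^{(a)}_j`. -/
abbrev Slot {N : ℕ} (n : ℕ) (lam : Fin N → ℕ) : Type :=
  Σ a : Fin (N - 1), Fin (levelSize n lam (a + 1))

/-- The formula for `W_J` with `w` in place of the inverses of the differences of the variables. -/
def inverseFreeW {N n : ℕ} {lam : Fin N → ℕ} (J : IndexSet n lam) (t : Variables n lam)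
    (b : Fin n → ℂ) (w : Slot n lam → Slot n lam → ℂ) : ℂ :=
  ∑ σ : (a : Fin (N - 1)) → Equiv.Perm (Fin (levelSize n lam (a + 1))),
    ∏ a : Fin (N - 1), ∏ j : Fin (levelSize n lam (a + 1)),
      ((∏ j' ∈ Finset.univ.filter (fun j' : Fin (levelSize n lam a) =>
            position J a j' < position J (a + 1) j),
          (t a (σ a j) - groups b (fun a j => t a (σ a j)) a j' + 1))
        * (∏ j' ∈ Finset.univ.filter (fun j' : Fin (levelSize n lam a) =>
            position J (a + 1) j < position J a j'),
          (t a (σ a j) - groups b (fun a j => t a (σ a j)) a j'))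
        * (∏ j' ∈ Finset.univ.filter (fun j' : Fin (levelSize n lam (a + 1)) => j < j'),
          (t a (σ a j) - t a (σ a j') + 1) * w ⟨a, σ a j⟩ ⟨a, σ a j'⟩))

theorem inverseFreeW_eq_weightW {N n : ℕ} {lam : Fin N → ℕ} (J : IndexSet n lam)
    (t : Variables n lam) (b : Fin n → ℂ) {w : Slot n lam → Slot n lam → ℂ}
    (hw : ∀ a j j', j ≠ j' → w ⟨a, j⟩ ⟨a, j'⟩ * (t a j - t a j') = 1) :
    inverseFreeW J t b w = weightW J t b := by
  refine Finset.sum_congr rfl fun σ _ => Finset.prod_congr rfl fun a _ =>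
    Finset.prod_congr rfl fun j _ => ?_
  congr 1
  refine Finset.prod_congr rfl fun j' hj' => ?_
  have hne : σ a j ≠ σ a j' := fun h => (Finset.mem_filter.1 hj').2.ne ((σ a).injective h)
  rw [div_eq_mul_inv, eq_inv_of_mul_eq_one_left (hw a _ _ hne)]

theorem inverseFreeW_mem_polyFun {ι : Type*} {N n : ℕ} {lam : Fin N → ℕ} (J : IndexSet n lam)
    {b : (ι → ℂ) → Fin n → ℂ} {t : (ι → ℂ) → Variables n lam}
    {w : (ι → ℂ) → Slot n lam → Slot n lam → ℂ}
    (hb : ∀ s, (fun y => b y s) ∈ polyFun ι) (ht : ∀ a j, (fun y => t y a j) ∈ polyFun ι)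
    (hw : ∀ s s', (fun y => w y s s') ∈ polyFun ι) :
    (fun y => inverseFreeW J (t y) (b y) (w y)) ∈ polyFun ι := by
  refine fun_sum_mem_polyFun _ fun σ _ => fun_prod_mem_polyFun _ fun a _ =>
    fun_prod_mem_polyFun _ fun j _ => ?_
  have hg : ∀ j', (fun y => t y a (σ a j) -
      groups (b y) (fun a j => t y a (σ a j)) a j') ∈ polyFun ι := fun j' =>
    fun_sub_mem_polyFun (ht _ _) (groups_mem_polyFun (t := fun y a j => t y a (σ a j)) hb
      (fun a j => ht a (σ a j)) _ _)
  refine fun_mul_mem_polyFun (fun_mul_mem_polyFun (fun_prod_mem_polyFun _ fun j' _ => ?_)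
    (fun_prod_mem_polyFun _ fun j' _ => ?_)) (fun_prod_mem_polyFun _ fun j' _ => ?_)
  · exact fun_add_mem_polyFun (hg j') (const_mem_polyFun 1)
  · exact hg j'
  · exact fun_mul_mem_polyFun (fun_add_mem_polyFun (fun_sub_mem_polyFun (ht _ _) (ht _ _))
      (const_mem_polyFun 1)) (hw _ _)

/-- The pairs of variables that are required to be distinct at an off-diagonal point. -/
def MustDiffer {N n : ℕ} {lam : Fin N → ℕ} (s s' : Slot n lam) : Prop :=
  (s.1 = s'.1 ∧ s ≠ s') ∨ (s'.1 : ℕ) = s.1 + 1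

theorem isOffDiagonal_iff {N n : ℕ} {lam : Fin N → ℕ} (t : Variables n lam) :
    IsOffDiagonal t ↔ ∀ s s' : Slot n lam, MustDiffer s s' → t s.1 s.2 ≠ t s'.1 s'.2 := by
  constructor
  · rintro ⟨h1, h2⟩ ⟨a, j⟩ ⟨a', j'⟩ (⟨haa, hne⟩ | haa)
    · simp only at haa
      subst haa
      rcases lt_trichotomy j j' with h | h | h
      · exact h1 a j j' h
      · exact absurd (by rw [h]) hne
      · exact (h1 a j' j h).symm
    · exact h2 a a' haa j j'
  · intro h
    exact ⟨fun a j j' hjj => h ⟨a, j⟩ ⟨a, j'⟩ (Or.inl ⟨rfl, by simpa using hjj.ne⟩),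
      fun a a' haa j j' => h ⟨a, j⟩ ⟨a', j'⟩ (Or.inr haa)⟩

/-- The auxiliary coordinates: the variables of one candidate solution for each `K ∈ 𝓘_λ`, inverses
for their differences, and an inverse for the determinant of the candidate Bethe vectors. -/
abbrev AuxIndex {N : ℕ} (n : ℕ) (lam : Fin N → ℕ) : Type :=
  Option (IndexSet n lam × (Slot n lam ⊕ Slot n lam × Slot n lam))

/-- The candidate solution with the label `K`. -/
def auxPoint {N n : ℕ} {lam : Fin N → ℕ} (y : Fin n ⊕ AuxIndex n lam → ℂ) (K : IndexSet n lam) :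
    Variables n lam :=
  fun a j => y (Sum.inr (some (K, Sum.inl ⟨a, j⟩)))

/-- The inverses of the differences of the variables of the candidate solution with the label
`K`. -/
def auxInverse {N n : ℕ} {lam : Fin N → ℕ} (y : Fin n ⊕ AuxIndex n lam → ℂ) (K : IndexSet n lam)
    (s s' : Slot n lam) : ℂ :=
  y (Sum.inr (some (K, Sum.inr (s, s'))))

/-- The equations saying that the candidates are off-diagonal solutions of the Bethe equations whose
Bethe vectors are linearly independent. -/
def AuxCondition {N n : ℕ} {lam : Fin N → ℕ} (q : Fin N → ℂ)
    (y : Fin n ⊕ AuxIndex n lam → ℂ) : Prop :=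
  (∀ K, IsBetheSolution q (fun s => y (Sum.inl s)) (auxPoint y K)) ∧
  (∀ K s s', MustDiffer s s' →
    auxInverse y K s s' * (auxPoint y K s.1 s.2 - auxPoint y K s'.1 s'.2) = 1) ∧
  y (Sum.inr none) * (Matrix.of fun K J : IndexSet n lam =>
    inverseFreeW J (auxPoint y K) (fun s => y (Sum.inl s)) (auxInverse y K)).det = 1

theorem isAlgebraicCondition_auxCondition {N n : ℕ} {lam : Fin N → ℕ} (q : Fin N → ℂ) :
    IsAlgebraicCondition (AuxCondition (n := n) (lam := lam) q) := by
  refine .and (.forall fun K => ?_) (.and (.forall fun K => .forall fun s => .forall fun s' =>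
    .forall fun _ => .of_eq ?_ (const_mem_polyFun 1)) (.of_eq ?_ (const_mem_polyFun 1)))
  · exact isAlgebraicCondition_isBetheSolution q (fun s => coord_mem_polyFun _)
      (fun a j => coord_mem_polyFun _)
  · exact fun_mul_mem_polyFun (coord_mem_polyFun _)
      (fun_sub_mem_polyFun (coord_mem_polyFun _) (coord_mem_polyFun _))
  · exact fun_mul_mem_polyFun (coord_mem_polyFun _) (fun_det_mem_polyFun fun K J =>
      inverseFreeW_mem_polyFun J (fun s => coord_mem_polyFun _) (fun a j => coord_mem_polyFun _)
        (fun s s' => coord_mem_polyFun _))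

/-- The auxiliary coordinates exist exactly when there are off-diagonal solutions whose Bethe
vectors have linearly independent coordinates. -/
theorem exists_auxCondition_iff {N n : ℕ} {lam : Fin N → ℕ} (q : Fin N → ℂ) (b : Fin n → ℂ) :
    (∃ x : AuxIndex n lam → ℂ, AuxCondition q (Sum.elim b x)) ↔
      ∃ sol : IndexSet n lam → Variables n lam,
        (∀ K, IsBetheSolution q b (sol K) ∧ IsOffDiagonal (sol K)) ∧
          (Matrix.of fun K J : IndexSet n lam => weightW J (sol K) b).det ≠ 0 := by
  constructor
  · rintro ⟨x, h1, h2, h3⟩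
    refine ⟨auxPoint (Sum.elim b x), fun K => ⟨h1 K, ?_⟩, ?_⟩
    · rw [isOffDiagonal_iff]
      intro s s' hss heq
      have := h2 K s s' hss
      rw [heq, sub_self, mul_zero] at this
      exact zero_ne_one this
    · intro hdet
      simp only [Sum.elim_inl] at h3
      simp only [inverseFreeW_eq_weightW _ _ b (fun a j j' hjj => h2 _ ⟨a, j⟩ ⟨a, j'⟩
        (Or.inl ⟨rfl, by simpa using hjj⟩)), hdet, mul_zero] at h3
      exact zero_ne_one h3
  · rintro ⟨sol, h1, hdet⟩
    let x : AuxIndex n lam → ℂ := fun k => match k with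
      | none => (Matrix.of fun K J : IndexSet n lam => weightW J (sol K) b).det⁻¹
      | some (K, Sum.inl s) => sol K s.1 s.2
      | some (K, Sum.inr (s, s')) => (sol K s.1 s.2 - sol K s'.1 s'.2)⁻¹
    have h2 : ∀ K s s', MustDiffer s s' →
        (sol K s.1 s.2 - sol K s'.1 s'.2)⁻¹ * (sol K s.1 s.2 - sol K s'.1 s'.2) = 1 :=
      fun K s s' hss => inv_mul_cancel₀
        (sub_ne_zero.2 ((isOffDiagonal_iff _).1 (h1 K).2 s s' hss))
    refine ⟨x, fun K => (h1 K).1, h2, ?_⟩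
    have hW : (Matrix.of fun K J : IndexSet n lam => inverseFreeW J (auxPoint (Sum.elim b x) K)
        (fun s => Sum.elim b x (Sum.inl s)) (auxInverse (Sum.elim b x) K)) =
        Matrix.of fun K J : IndexSet n lam => weightW J (sol K) b := by
      ext K J
      exact inverseFreeW_eq_weightW J (sol K) b fun a j j' hjj =>
        h2 K ⟨a, j⟩ ⟨a, j'⟩ (Or.inl ⟨rfl, by simpa using hjj⟩)
    rw [hW]
    exact inv_mul_cancel₀ hdet

/-- Along the line through a point with distinct coordinates, cluster solutions with linearly
independent Bethe vectors exist near infinity. -/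
theorem eventually_exists_solutions {N n : ℕ} {lam : Fin N → ℕ} {q : Fin N → ℂ}
    (hq0 : ∀ i, q i ≠ 0) (hq : Function.Injective q) {b : Fin n → ℂ}
    (hb : Function.Injective b) :
    ∀ᶠ ε in nhdsWithin (0 : ℂ) {0}ᶜ, ∃ sol : IndexSet n lam → Variables n lam,
      (∀ K, IsBetheSolution q (fun s => ε⁻¹ * b s) (sol K) ∧ IsOffDiagonal (sol K)) ∧
        (Matrix.of fun K J : IndexSet n lam =>
          weightW J (sol K) (fun s => ε⁻¹ * b s)).det ≠ 0 := by
  choose z z₀ hz hsol using fun I : IndexSet n lam => exists_cluster_solution I hq0 hq hb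
  filter_upwards [Filter.eventually_all.2 hsol, eventually_det_weightW_ne_zero hb hz]
    with ε h1 h2
  exact ⟨fun I => clusterPoint I b ε (z I ε), h1, h2⟩

end XXX

end

theorem mainTheorem7 (N n : ℕ) (q : Fin N → ℂ) (hq0 : ∀ i, q i ≠ 0)
    (hq : Function.Injective q) (lam : Fin N → ℕ) (hlam : ∑ i, lam i = n) :
    ∃ P : MvPolynomial (Fin n) ℂ, P ≠ 0 ∧
      ∀ b : Fin n → ℂ, MvPolynomial.eval b P ≠ 0 →
        ∃ (ι : Type) (sol : ι → XXX.Variables n lam),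
          (∀ k, XXX.IsBetheSolution q b (sol k) ∧ XXX.IsOffDiagonal (sol k)) ∧
          ∃ B : Module.Basis ι ℂ (XXX.weightSpace n lam),
            ∀ k, (B k : XXX.TensorSpace N n) = XXX.universalWeight (sol k) b := by
  obtain ⟨S, hS⟩ := XXX.isAlgebraicCondition_auxCondition (n := n) (lam := lam) q
  obtain ⟨P, hP, h⟩ := XXX.exists_ne_zero_of_dense_projection S fun Q hQ => by
    refine XXX.eq_zero_of_frequently_eval_eq_zero Q fun b hb => ?_
    refine (XXX.eventually_exists_solutions (lam := lam) hq0 hq hb).frequently.mono fun ε hε => ?_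
    obtain ⟨x, hx⟩ := (XXX.exists_auxCondition_iff q _).2 hε
    exact hQ _ x ((hS _).1 hx)
  refine ⟨P, hP, fun b hb => ?_⟩
  obtain ⟨x, hx⟩ := h b hb
  obtain ⟨sol, hsol, hdet⟩ := (XXX.exists_auxCondition_iff q b).1 ⟨x, (hS _).2 hx⟩
  obtain ⟨B, hB⟩ := XXX.exists_basis_of_det_ne_zero _ hdet
  exact ⟨_, sol, hsol, B, hB⟩
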